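/- Let $\mathrm{wMPT}$ be the statement, formalized as a sentence of second order arithmetic: for every tree $T\subseteq\omega^{<\omega}$, if $[T]$ (the set of infinite paths through $T$) is cofinal, i.e. for every real $x$ there is $y\in[T]$ with $y\ge_{\mathrm T}x$, then $T$ has a perfect subtree, i.e. there is a nonempty tree $S\subseteq T$ in which every node has two incomparable extensions. Then $\mathrm{ACA}_0$ does not imply $\mathrm{wMPT}$: some model of $\mathrm{ACA}_0$ is not a model of $\mathrm{wMPT}$. In fact, let $\mathcal M=(\omega,M,0,1,+,\cdot,<)$ be the $\omega$-model of the arithmetical reals, $M=\{x\mid \exists n\,(x\le_{\mathrm T}\emptyset^{(n)})\}$. Then $\mathcal M\models\mathrm{ACA}_0$ and $\mathcal M\not\models\mathrm{wMPT}$. Moreover, there is a sequence $(T_n)_{n\in\omega}$ of uniformly recursive trees $T_n\subseteq\omega^{<\omega}$ such that, for every $n$, $[T_n]$ consists of a single real, which has Turing degree $\mathbf 0^{(n)}$, and the tree $T=\{\langle\rangle\}\cup\bigcup_{n\in\omega}n^{\smallfrown}T_n$ is recursive, $[T]$ is countable, $[T]$ is cofinal in $M$ (for every $x\in M$ there is $y\in[T]\cap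 M$ with $y\ge_{\mathrm T}x$), and $T$ has no perfect subtree at all (in particular none in $\mathcal M$). -/

import Mathlib

/-! ## Relative computability, the Turing jump, arithmetical reals -/

/-- The characteristic function of a set of natural numbers. -/
noncomputable def charFun (X : Set ℕ) : ℕ → ℕ :=
  open Classical in fun n => if n ∈ X then 1 else 0

/-- Turing reducibility of total functions `ℕ → ℕ`. -/
def TuringLE (f g : ℕ → ℕ) : Prop :=
  TuringReducible (f : ℕ →. ℕ) (g : ℕ →. ℕ)

/-- Programs for partial functions that are recursive in an oracle. -/
inductive OracleCode : Type
  | zero : OracleCode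
  | succ : OracleCode
  | left : OracleCode
  | right : OracleCode
  | oracle : OracleCode
  | pair : OracleCode → OracleCode → OracleCode
  | comp : OracleCode → OracleCode → OracleCode
  | prec : OracleCode → OracleCode → OracleCode
  | rfind : OracleCode → OracleCode

namespace OracleCode

/-- The partial function computed by a program with oracle `g`; the clauses are those of
`Nat.RecursiveIn`. -/
def eval (g : ℕ → ℕ) : OracleCode → ℕ →. ℕ
  | zero => fun _ => Part.some 0
  | succ => fun n => Part.some (n + 1)
  | left => fun n => Part.some n.unpair.1
  | right => fun n => Part.some n.unpair.2
  | oracle => fun n => Part.some (g n)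
  | pair c d => fun n => Nat.pair <$> eval g c n <*> eval g d n
  | comp c d => fun n => eval g d n >>= eval g c
  | prec c d => fun p =>
      p.unpair.2.rec (eval g c p.unpair.1) fun y ih => do
        let i ← ih
        eval g d (Nat.pair p.unpair.1 (Nat.pair y i))
  | rfind c => fun a => Nat.rfind fun n => (fun m => m = 0) <$> eval g c (Nat.pair a n)

/-- The index (Gödel number) of a program. -/
def index : OracleCode → ℕ
  | zero => Nat.pair 0 0
  | succ => Nat.pair 1 0
  | left => Nat.pair 2 0
  | right => Nat.pair 3 0
  | oracle => Nat.pair 4 0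
  | pair c d => Nat.pair 5 (Nat.pair c.index d.index)
  | comp c d => Nat.pair 6 (Nat.pair c.index d.index)
  | prec c d => Nat.pair 7 (Nat.pair c.index d.index)
  | rfind c => Nat.pair 8 c.index

end OracleCode

/-- The Turing jump `X' = {e | Φ_e^X(e)↓}`. -/
def turingJump (X : Set ℕ) : Set ℕ :=
  {e | ∃ c : OracleCode, c.index = e ∧ (c.eval (charFun X) e).Dom}

/-- The `n`-th jump `∅⁽ⁿ⁾` of the empty set. -/
def zeroJump (n : ℕ) : Set ℕ := turingJump^[n] ∅

/-- A real `x ∈ ω^ω` is arithmetical if `x ≤_T ∅⁽ⁿ⁾` for some `n`. -/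
def IsArithmeticalReal (x : ℕ → ℕ) : Prop := ∃ n, TuringLE x (charFun (zeroJump n))

/-! ## Trees of finite sequences of natural numbers -/

/-- A tree is a set of finite sequences closed under initial segments. -/
def IsTree (T : Set (List ℕ)) : Prop := ∀ σ ∈ T, ∀ τ, τ <+: σ → τ ∈ T

/-- The set `[T]` of infinite paths through `T`. -/
def treePaths (T : Set (List ℕ)) : Set (ℕ → ℕ) := {x | ∀ n, (List.range n).map x ∈ T}

/-- A perfect tree is a nonempty tree in which every node has two incomparable extensions. -/
def IsPerfectTree (S : Set (List ℕ)) : Prop :=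
  IsTree S ∧ S.Nonempty ∧
    ∀ σ ∈ S, ∃ τ ∈ S, ∃ υ ∈ S, σ <+: τ ∧ σ <+: υ ∧ ¬ τ <+: υ ∧ ¬ υ <+: τ

/-- The tree `⋃ₙ n⌢Tₙ` (with its root). -/
def unionTree (T : ℕ → Set (List ℕ)) : Set (List ℕ) :=
  {σ | σ = [] ∨ ∃ n, ∃ τ ∈ T n, σ = n :: τ}

/-! ## Second order arithmetic: language, structures, satisfaction -/

/-- Numerical terms of the language of second order arithmetic. -/
inductive L2Term : Type
  | var : ℕ → L2Term
  | zero : L2Term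
  | one : L2Term
  | add : L2Term → L2Term → L2Term
  | mul : L2Term → L2Term → L2Term

/-- Formulas of second order arithmetic, with number variables `x₀, x₁, …` and set variables
`X₀, X₁, …`. -/
inductive L2Formula : Type
  | eq : L2Term → L2Term → L2Formula
  | lt : L2Term → L2Term → L2Formula
  | mem : L2Term → ℕ → L2Formula
  | neg : L2Formula → L2Formula
  | and : L2Formula → L2Formula → L2Formula
  | allNum : ℕ → L2Formula → L2Formula
  | allSet : ℕ → L2Formula → L2Formula

namespace L2Formula

def or (φ ψ : L2Formula) : L2Formula := neg (and (neg φ) (neg ψ))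
def imp (φ ψ : L2Formula) : L2Formula := neg (and φ (neg ψ))
def iff (φ ψ : L2Formula) : L2Formula := and (imp φ ψ) (imp ψ φ)
def exNum (i : ℕ) (φ : L2Formula) : L2Formula := neg (allNum i (neg φ))
def exSet (i : ℕ) (φ : L2Formula) : L2Formula := neg (allSet i (neg φ))

/-- A formula is arithmetical if it has no set quantifiers. -/
def IsArithmetical : L2Formula → Prop
  | eq _ _ => True
  | lt _ _ => True
  | mem _ _ => True
  | neg φ => φ.IsArithmetical
  | and φ ψ => φ.IsArithmetical ∧ ψ.IsArithmetical
  | allNum _ φ => φ.IsArithmetical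
  | allSet _ _ => False

/-- The set variable `Xᵢ` occurs free in the formula. -/
def SetVarFree (i : ℕ) : L2Formula → Prop
  | eq _ _ => False
  | lt _ _ => False
  | mem _ j => i = j
  | neg φ => φ.SetVarFree i
  | and φ ψ => φ.SetVarFree i ∨ ψ.SetVarFree i
  | allNum _ φ => φ.SetVarFree i
  | allSet j φ => i ≠ j ∧ φ.SetVarFree i

end L2Formula

/-- Structures for second order arithmetic `(N, M, 0, 1, +, ·, <)`: the second sort `M` is a
nonempty collection of subsets of the first sort `N`. -/
structure L2Structure : Type 1 where
  Num : Type
  sets : Set (Set Num)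
  sets_nonempty : sets.Nonempty
  zero : Num
  one : Num
  add : Num → Num → Num
  mul : Num → Num → Num
  lt : Num → Num → Prop

namespace L2Structure

def termValue (M : L2Structure) (v : ℕ → M.Num) : L2Term → M.Num
  | .var i => v i
  | .zero => M.zero
  | .one => M.one
  | .add s t => M.add (M.termValue v s) (M.termValue v t)
  | .mul s t => M.mul (M.termValue v s) (M.termValue v t)

/-- Tarskian satisfaction under an assignment `v` of the number variables and `V` of the set
variables. -/
def Realize (M : L2Structure) : L2Formula → (ℕ → M.Num) → (ℕ → M.sets) → Prop
  | .eq s t, v, _ => M.termValue v s = M.termValue v t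
  | .lt s t, v, _ => M.lt (M.termValue v s) (M.termValue v t)
  | .mem t i, v, V => M.termValue v t ∈ (V i : Set M.Num)
  | .neg φ, v, V => ¬ M.Realize φ v V
  | .and φ ψ, v, V => M.Realize φ v V ∧ M.Realize ψ v V
  | .allNum i φ, v, V => ∀ n : M.Num, M.Realize φ (Function.update v i n) V
  | .allSet i φ, v, V => ∀ X : M.sets, M.Realize φ v (Function.update V i X)

/-- `M ⊨ φ`: the universal closure of `φ` is true in `M`. -/
def Models (M : L2Structure) (φ : L2Formula) : Prop := ∀ v V, M.Realize φ v V

/-- `M ⊨ Γ` for a set `Γ` of axioms. -/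
def ModelsTheory (M : L2Structure) (Γ : Set L2Formula) : Prop := ∀ φ ∈ Γ, M.Models φ

/-- The `ω`-model whose second sort is the given nonempty collection of sets. -/
def omega (S : Set (Set ℕ)) (hS : S.Nonempty) : L2Structure where
  Num := ℕ
  sets := S
  sets_nonempty := hS
  zero := 0
  one := 1
  add := (· + ·)
  mul := (· * ·)
  lt := (· < ·)

end L2Structure

/-- `Γ` implies `φ`: every model of `Γ` is a model of `φ`. -/
def TheoryImplies (Γ : Set L2Formula) (φ : L2Formula) : Prop :=
  ∀ M : L2Structure, M.ModelsTheory Γ → M.Models φ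

/-! ## The theory `ACA₀` -/

namespace ACA

open L2Term L2Formula

/-- The basic axioms of arithmetic. -/
def basicAxioms : Set L2Formula :=
  { neg (eq (add (var 0) one) zero),
    imp (eq (add (var 0) one) (add (var 1) one)) (eq (var 0) (var 1)),
    eq (add (var 0) zero) (var 0),
    eq (add (var 0) (add (var 1) one)) (add (add (var 0) (var 1)) one),
    eq (mul (var 0) zero) zero,
    eq (mul (var 0) (add (var 1) one)) (add (mul (var 0) (var 1)) (var 0)),
    neg (lt (var 0) zero),
    iff (lt (var 0) (add (var 1) one)) (or (lt (var 0) (var 1)) (eq (var 0) (var 1))) }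

/-- The induction axiom `0 ∈ X ∧ ∀ n (n ∈ X → n + 1 ∈ X) → ∀ n (n ∈ X)`. -/
def inductionAxiom : L2Formula :=
  imp (and (mem zero 0) (allNum 0 (imp (mem (var 0) 0) (mem (add (var 0) one) 0))))
    (allNum 0 (mem (var 0) 0))

/-- The instance `∃ Xᵢ ∀ xⱼ (xⱼ ∈ Xᵢ ↔ φ)` of comprehension. -/
def comprehension (i j : ℕ) (φ : L2Formula) : L2Formula :=
  exSet i (allNum j (iff (mem (var j) i) φ))

end ACA

/-- `ACA₀`: basic axioms, the induction axiom, and comprehension for all arithmetical formulas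
(with number and set parameters). -/
def ACA0 : Set L2Formula :=
  ACA.basicAxioms ∪ {ACA.inductionAxiom} ∪
    {ψ | ∃ (i j : ℕ) (φ : L2Formula), φ.IsArithmetical ∧ ¬ φ.SetVarFree i ∧
      ψ = ACA.comprehension i j φ}

/-! ## The sentence `wMPT`

To write long formulas without managing variable names by hand, a `Scheme` is a formula that
depends on the first unused number variable and the first unused set variable; the quantifiers
below bind that variable and pass it on to their body. -/

/-- A formula depending on the first unused number variable and the first unused set variable. -/
abbrev Scheme : Type := ℕ → ℕ → L2Formula

namespace Scheme

open L2Term (zero one add mul)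

def eq (s t : L2Term) : Scheme := fun _ _ => .eq s t
def lt (s t : L2Term) : Scheme := fun _ _ => .lt s t
def mem (t : L2Term) (X : ℕ) : Scheme := fun _ _ => .mem t X
def neg (A : Scheme) : Scheme := fun k l => .neg (A k l)
def and (A B : Scheme) : Scheme := fun k l => .and (A k l) (B k l)
def or (A B : Scheme) : Scheme := fun k l => .or (A k l) (B k l)
def imp (A B : Scheme) : Scheme := fun k l => .imp (A k l) (B k l)
def iff (A B : Scheme) : Scheme := fun k l => .iff (A k l) (B k l)
def all (A : L2Term → Scheme) : Scheme := fun k l => .allNum k (A (.var k) (k + 1) l)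
def ex (A : L2Term → Scheme) : Scheme := fun k l => .exNum k (A (.var k) (k + 1) l)
def allSet (A : ℕ → Scheme) : Scheme := fun k l => .allSet l (A l k (l + 1))
def exSet (A : ℕ → Scheme) : Scheme := fun k l => .exSet l (A l k (l + 1))

local infixr:35 " ⋀ " => Scheme.and
local infixr:30 " ⋁ " => Scheme.or
local infixr:25 " ⟹ " => Scheme.imp
local infix:20 " ⟺ " => Scheme.iff
local infix:50 " ≐ " => Scheme.eq
local infix:50 " ≺ " => Scheme.lt

def numeral : ℕ → L2Term
  | 0 => zero
  | n + 1 => add (numeral n) one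

/-- `p` is the code `Nat.pair a b` of the pair `(a, b)`. -/
def isPair (p a b : L2Term) : Scheme :=
  (a ≺ b ⋀ p ≐ add (mul b b) a) ⋁ (neg (a ≺ b) ⋀ p ≐ add (add (mul a a) a) b)

/-- `(a, b) ∈ X`. -/
def pairMem (a b : L2Term) (X : ℕ) : Scheme := ex fun p => isPair p a b ⋀ mem p X

/-! Finite sequences are coded with Gödel's `β` function: `s = (l, (a, b))` codes the sequence of
length `l` whose `i`-th entry is the remainder of `a` modulo `(i + 1) * b + 1`. -/

/-- The sequence coded by `s` has length `l`. -/
def hasLength (s l : L2Term) : Scheme := ex fun c => isPair s l c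

/-- The `i`-th entry of the sequence coded by `s` exists and is `x`. -/
def entry (s i x : L2Term) : Scheme :=
  ex fun l => ex fun c => ex fun a => ex fun b =>
    isPair s l c ⋀ isPair c a b ⋀ i ≺ l ⋀
      x ≺ add (mul (add i one) b) one ⋀
      ex fun q => a ≐ add (mul q (add (mul (add i one) b) one)) x

/-- `s` and `t` code the same sequence. -/
def sameSeq (s t : L2Term) : Scheme :=
  (ex fun l => hasLength s l ⋀ hasLength t l) ⋀
    all fun i => all fun x => entry s i x ⟺ entry t i x

/-- `s` is the least code of the sequence that it codes; these numbers represent `ω^{<ω}`. -/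
def isSeq (s : L2Term) : Scheme := all fun t => t ≺ s ⟹ neg (sameSeq t s)

/-- The sequence coded by `s` is an initial segment of the one coded by `t`. -/
def isPrefix (s t : L2Term) : Scheme :=
  (ex fun l => ex fun m => hasLength s l ⋀ hasLength t m ⋀ neg (m ≺ l)) ⋀
    all fun i => all fun x => entry s i x ⟹ entry t i x

/-- `T ⊆ ω^{<ω}` is a tree. -/
def isTree (T : ℕ) : Scheme :=
  all fun s => mem s T ⟹ (isSeq s ⋀ all fun t => (isSeq t ⋀ isPrefix t s) ⟹ mem t T)

/-- `F` is (the graph of) a function from numbers to numbers. -/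
def isFunction (F : ℕ) : Scheme :=
  (all fun n => ex fun m => pairMem n m F) ⋀
    all fun n => all fun m => all fun m' => (pairMem n m F ⋀ pairMem n m' F) ⟹ m ≐ m'

/-- The function `F` is an infinite path through `T`. -/
def isPath (F T : ℕ) : Scheme :=
  isFunction F ⋀
    all fun s => (isSeq s ⋀ all fun i => all fun x => entry s i x ⟹ pairMem i x F) ⟹ mem s T

/-- `S` is a perfect tree. -/
def isPerfect (S : ℕ) : Scheme :=
  isTree S ⋀ (ex fun s => mem s S) ⋀
    all fun s => mem s S ⟹ ex fun t => ex fun u => mem t S ⋀ mem u S ⋀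
      isPrefix s t ⋀ isPrefix s u ⋀ neg (isPrefix t u) ⋀ neg (isPrefix u t)

/-- One of the first `i` entries of the sequence `d` is the triple `(e, (a, b))`. -/
def listedBefore (d i e a b : L2Term) : Scheme :=
  ex fun j => ex fun p => ex fun r =>
    j ≺ i ⋀ entry d j p ⋀ isPair p e r ⋀ isPair r a b

/-- The claim `Φ_e^Y(a) = b` follows in one step, according to the clauses defining
`OracleCode.eval` and `OracleCode.index`, from claims among the first `i` entries of `d`. -/
def justified (Y : ℕ) (d i e a b : L2Term) : Scheme :=
  (isPair e (numeral 0) zero ⋀ b ≐ zero) ⋁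
  (isPair e (numeral 1) zero ⋀ b ≐ add a one) ⋁
  (isPair e (numeral 2) zero ⋀ ex fun r => isPair a b r) ⋁
  (isPair e (numeral 3) zero ⋀ ex fun r => isPair a r b) ⋁
  (isPair e (numeral 4) zero ⋀ ((mem a Y ⋀ b ≐ one) ⋁ (neg (mem a Y) ⋀ b ≐ zero))) ⋁
  (ex fun cd => ex fun c => ex fun c' => isPair e (numeral 5) cd ⋀ isPair cd c c' ⋀
    ex fun u => ex fun w =>
      listedBefore d i c a u ⋀ listedBefore d i c' a w ⋀ isPair b u w) ⋁
  (ex fun cd => ex fun c => ex fun c' => isPair e (numeral 6) cd ⋀ isPair cd c c' ⋀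
    ex fun u => listedBefore d i c' a u ⋀ listedBefore d i c u b) ⋁
  (ex fun cd => ex fun c => ex fun c' => isPair e (numeral 7) cd ⋀ isPair cd c c' ⋀
    ex fun x => ex fun n => isPair a x n ⋀
      ((n ≐ zero ⋀ listedBefore d i c x b) ⋁
        ex fun m => ex fun a' => ex fun u => ex fun z => ex fun w =>
          n ≐ add m one ⋀ isPair a' x m ⋀ listedBefore d i e a' u ⋀
          isPair z m u ⋀ isPair w x z ⋀ listedBefore d i c' w b)) ⋁
  (ex fun c => isPair e (numeral 8) c ⋀
    (ex fun z => isPair z a b ⋀ listedBefore d i c z zero) ⋀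
    all fun m => m ≺ b ⟹ ex fun z => ex fun u =>
      isPair z a m ⋀ listedBefore d i c z (add u one))

/-- `d` is a computation record with oracle `Y`: a finite sequence of claims `(e, (a, b))`, read
`Φ_e^Y(a) = b`, each of which is justified by earlier ones. -/
def isRecord (Y : ℕ) (d : L2Term) : Scheme :=
  all fun i => all fun p => entry d i p ⟹
    ex fun e => ex fun r => ex fun a => ex fun b =>
      isPair p e r ⋀ isPair r a b ⋀ justified Y d i e a b

/-- `Φ_e^Y(a) = b`. -/
def computes (Y : ℕ) (e a b : L2Term) : Scheme :=
  ex fun d => ex fun l => isRecord Y d ⋀ hasLength d l ⋀ listedBefore d l e a b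

/-- `X ≤_T Y`: some `Φ_e^Y` is the characteristic function of `X`. -/
def turingLE (X Y : ℕ) : Scheme :=
  ex fun e => all fun n =>
    (mem n X ⟹ computes Y e n one) ⋀ (neg (mem n X) ⟹ computes Y e n zero)

/-- `[T]` is cofinal in the Turing degrees. -/
def isCofinal (T : ℕ) : Scheme :=
  allSet fun X => exSet fun F => isPath F T ⋀ turingLE X F

/-- `S` is a subset of `T`. -/
def isSubset (S T : ℕ) : Scheme := all fun s => mem s S ⟹ mem s T

end Scheme

/-- Weak Martin's pointed tree theorem: every tree `T ⊆ ω^{<ω}` with `[T]` cofinal has a perfect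
subtree. -/
def wMPT : L2Formula :=
  (Scheme.allSet fun T => Scheme.imp (Scheme.and (Scheme.isTree T) (Scheme.isCofinal T))
    (Scheme.exSet fun S => Scheme.and (Scheme.isPerfect S) (Scheme.isSubset S T))) 0 0

/-! ## The `ω`-model of arithmetical reals -/

/-- The sets of natural numbers recursive in some `∅⁽ⁿ⁾`. -/
def arithmeticalSets : Set (Set ℕ) := {X | IsArithmeticalReal (charFun X)}

theorem arithmeticalSets_nonempty : arithmeticalSets.Nonempty :=
  ⟨∅, 0, TuringReducible.refl _⟩

/-- The `ω`-model whose second sort consists of the arithmetical sets. -/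
def arithmeticalModel : L2Structure :=
  L2Structure.omega arithmeticalSets arithmeticalSets_nonempty

/-! ## Turing reducibility: closure properties -/

/-! The heart of the matter is that the degree of each finite jump contains a real that is the only
path of a recursive tree. A set such as ∅⁽ⁿ⁾ need not be such a path itself, since membership in a
jump is an existential fact that no finite stage can refute. The remedy is to record a witness:
`jumpStage (k + 1) e` is one plus the least code of a halting computation showing that e lies in
∅⁽ᵏ⁺¹⁾, or 0. Relative to ∅⁽ᵏ⁾ the equation `jumpStage (k + 1) e = v` becomes a universal statement
over d whose instances each read only finitely many oracle values (`jumpStage_succ_eq_iff`).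

The real `jumpPath n` stacks the columns k ≤ n. The oracle needed to check column k + 1 is the
support of column k, so it is part of the same real, and being `jumpPath n` is an effectively closed
condition uniformly in n (`forall_jumpCondition_iff`). The finite sequences that do not visibly
violate it form `jumpTree n`. Its path has degree 𝟎⁽ⁿ⁾: the last column computes ∅⁽ⁿ⁾, and ∅⁽ⁿ⁾
computes all columns.

The paths through the union tree are the reals n⌢`jumpPath n`. They are countable in number,
arithmetical, and cofinal among the arithmetical reals. A perfect subtree would extend two
incomparable nodes above a nonempty node to two distinct paths with the same first entry n, hence to
two paths through the n-th tree (`not_isPerfectTree_of_subset_unionTree`).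

The arithmetical sets satisfy arithmetical comprehension because each number quantifier costs one
jump (`turingLE_turingJump_of_projection`, `definable_mem_arithmeticalSets`). To refute the formal
sentence, `sat_wMPT` evaluates it in the model. Its clauses about computations are matched with the
semantic notion of a record, a list of claims Φ_e(a) = b each justified by earlier ones. Such
records also serve as the witnesses for membership in a jump. -/

theorem charFun_le_one (X : Set ℕ) (n : ℕ) : charFun X n ≤ 1 := by
  unfold charFun; split <;> simp

theorem charFun_of_mem {X : Set ℕ} {n : ℕ} (h : n ∈ X) : charFun X n = 1 := by
  simp [charFun, h]

theorem charFun_of_notMem {X : Set ℕ} {n : ℕ} (h : n ∉ X) : charFun X n = 0 := by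
  simp [charFun, h]

theorem charFun_eq_one_iff {X : Set ℕ} {n : ℕ} : charFun X n = 1 ↔ n ∈ X := by
  unfold charFun; split <;> simp_all

/-- A partial function is recursive in the total function `g`. -/
abbrev PartRecIn (g : ℕ → ℕ) (f : ℕ →. ℕ) : Prop := Nat.RecursiveIn {(g : ℕ →. ℕ)} f

namespace TuringLE

variable {f g h k : ℕ → ℕ}

theorem iff_partRecIn : TuringLE f g ↔ PartRecIn g (fun n => Part.some (f n)) :=
  RecursiveIn.iff_nat

protected theorem refl (f : ℕ → ℕ) : TuringLE f f := TuringReducible.refl _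

protected theorem trans (hf : TuringLE f g) (hg : TuringLE g h) : TuringLE f h :=
  TuringReducible.trans hf hg

theorem of_computable (hf : Computable f) : TuringLE f g :=
  Partrec.turingReducible hf

theorem of_primrec (hf : Primrec f) : TuringLE f g := of_computable hf.to_comp

theorem comp (hf : TuringLE f g) (hh : TuringLE h g) : TuringLE (fun n => f (h n)) g := by
  rw [iff_partRecIn] at *
  exact (Nat.RecursiveIn.comp hf hh).of_eq fun n => by simp

theorem pair (hf : TuringLE f g) (hh : TuringLE h g) :
    TuringLE (fun n => Nat.pair (f n) (h n)) g := by
  rw [iff_partRecIn] at *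
  exact (Nat.RecursiveIn.pair hf hh).of_eq fun n => by simp [Seq.seq]

theorem computable₂_comp {F : ℕ → ℕ → ℕ} (hF : Computable₂ F) (hf : TuringLE f g)
    (hh : TuringLE h g) : TuringLE (fun n => F (f n) (h n)) g := by
  have : Computable fun p : ℕ => F p.unpair.1 p.unpair.2 :=
    hF.comp (Computable.fst.comp Computable.unpair) (Computable.snd.comp Computable.unpair)
  simpa using (of_computable this).comp (hf.pair hh)

/-- The initial segments of a function are uniformly recursive in it. -/
theorem encode_map_range (g : ℕ → ℕ) :
    TuringLE (fun n => Encodable.encode ((List.range n).map g)) g := by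
  have step : TuringLE (fun p => Encodable.encode
      (((Encodable.decode (α := List ℕ) p.unpair.2.unpair.2).getD [])
        ++ [g p.unpair.2.unpair.1])) g := by
    refine computable₂_comp (F := fun p m => Encodable.encode
      (((Encodable.decode (α := List ℕ) p.unpair.2.unpair.2).getD []) ++ [m] : List ℕ))
      (f := fun p => p) (h := fun p => g p.unpair.2.unpair.1) ?_ (of_primrec Primrec.id) ?_
    · refine (Primrec.encode.comp (Primrec.list_append.comp (?_ : Primrec fun p : ℕ × ℕ => _) ?_)).to_comp
      · refine Primrec.option_getD.comp (Primrec.decode.comp ?_) (Primrec.const [])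
        exact Primrec.snd.comp (Primrec.unpair.comp
          (Primrec.snd.comp (Primrec.unpair.comp Primrec.fst)))
      · exact Primrec.list_cons.comp Primrec.snd (Primrec.const [])
    · refine comp (f := g) (.refl g) (of_primrec ?_)
      exact Primrec.fst.comp (Primrec.unpair.comp (Primrec.snd.comp Primrec.unpair))
  have base : TuringLE (fun _ => Encodable.encode ([] : List ℕ)) g := of_primrec (Primrec.const _)
  rw [iff_partRecIn] at step base
  have := Nat.RecursiveIn.prec base step
  -- Primitive recursion comes with a parameter, the first component of p. It plays no role and is
  -- set to 0 at the end.
  have h2 : TuringLE (fun p => Encodable.encode ((List.range p.unpair.2).map g)) g := by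
    rw [iff_partRecIn]
    refine this.of_eq fun p => ?_
    dsimp only
    generalize p.unpair.1 = a
    induction p.unpair.2 with
    | zero => simp
    | succ n ih =>
      dsimp only at ih ⊢
      rw [ih]
      simp [List.range_succ]
  simpa using h2.comp (f := _) ((of_primrec (Primrec.const 0)).pair (of_primrec Primrec.id))

/-- A function that is computed from a recursively bounded initial segment of `g` is recursive
in `g`. -/
theorem of_bounded_use {F : List ℕ → ℕ → ℕ} {u : ℕ → ℕ} (hF : Computable₂ F) (hu : Computable u)
    (g : ℕ → ℕ) : TuringLE (fun n => F ((List.range (u n)).map g) n) g := by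
  have h1 : TuringLE (fun n => Encodable.encode ((List.range (u n)).map g)) g :=
    (encode_map_range g).comp (of_computable hu)
  have h2 : Computable₂ fun l n : ℕ => F ((Encodable.decode (α := List ℕ) l).getD []) n := by
    refine hF.comp ?_ Computable.snd
    exact (Primrec.option_getD.comp (Primrec.decode.comp Primrec.fst)
      (Primrec.const [])).to_comp
  simpa using computable₂_comp h2 h1 (of_primrec Primrec.id)

/-- The search for the least `m` with `(n, m) ∈ R`. -/
noncomputable def search (R : Set ℕ) : ℕ →. ℕ := fun n =>
  Nat.rfind ((fun m => decide (charFun R (Nat.pair n m) = 1) : ℕ → Bool) : ℕ →. Bool)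

theorem partRecIn_search {R : Set ℕ} (hR : TuringLE (charFun R) g) : PartRecIn g (search R) := by
  -- Minimization looks for the value 0, so the characteristic function is flipped.
  have h1 : TuringLE (fun p => 1 - charFun R p) g :=
    computable₂_comp (F := fun a b : ℕ => a - b) Primrec.nat_sub.to_comp
      (of_primrec (Primrec.const 1)) hR
  rw [iff_partRecIn] at h1
  refine (Nat.RecursiveIn.rfind h1).of_eq fun n => ?_
  refine congrArg Nat.rfind (funext fun m => ?_)
  have := charFun_le_one R (Nat.pair n m)
  simp only [Part.map_eq_map, Part.map_some, PFun.coe_val, Part.some_inj, decide_eq_decide]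
  omega

theorem mem_search {R : Set ℕ} {n m : ℕ} :
    m ∈ search R n ↔ Nat.pair n m ∈ R ∧ ∀ k < m, Nat.pair n k ∉ R := by
  refine Nat.mem_rfind.trans ?_
  simp [charFun_eq_one_iff]

theorem search_dom {R : Set ℕ} {n : ℕ} : (search R n).Dom ↔ ∃ m, Nat.pair n m ∈ R := by
  refine Nat.rfind_dom.trans ?_
  simp [charFun_eq_one_iff]

/-- Unbounded search, which halts everywhere because f n is always a solution. -/
theorem find_of_charFun {R : Set ℕ} (hR : TuringLE (charFun R) g)
    (hf : ∀ n, Nat.pair n (f n) ∈ R) (hmin : ∀ n, ∀ m < f n, Nat.pair n m ∉ R) :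
    TuringLE f g := by
  rw [iff_partRecIn]
  exact (partRecIn_search hR).of_eq_tot fun n => mem_search.2 ⟨hf n, hmin n⟩

end TuringLE

/-! ## Programs -/

namespace OracleCode

theorem exists_code {g : ℕ → ℕ} {f : ℕ →. ℕ} (hf : PartRecIn g f) :
    ∃ c : OracleCode, c.eval g = f := by
  induction hf with
  | zero => exact ⟨zero, rfl⟩
  | succ => exact ⟨succ, rfl⟩
  | left => exact ⟨left, rfl⟩
  | right => exact ⟨right, rfl⟩
  | oracle k hk => obtain rfl : k = _ := hk; exact ⟨oracle, rfl⟩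
  | pair _ _ ih₁ ih₂ =>
    obtain ⟨c, rfl⟩ := ih₁; obtain ⟨d, rfl⟩ := ih₂; exact ⟨.pair c d, rfl⟩
  | comp _ _ ih₁ ih₂ =>
    obtain ⟨c, rfl⟩ := ih₁; obtain ⟨d, rfl⟩ := ih₂; exact ⟨.comp c d, rfl⟩
  | prec _ _ ih₁ ih₂ =>
    obtain ⟨c, rfl⟩ := ih₁; obtain ⟨d, rfl⟩ := ih₂; exact ⟨.prec c d, rfl⟩
  | rfind _ ih => obtain ⟨c, rfl⟩ := ih; exact ⟨.rfind c, rfl⟩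

theorem index_injective : Function.Injective index := by
  intro c
  induction c with
  | zero | succ | left | right | oracle =>
    intro d h; cases d <;> simp [index, Nat.pair_eq_pair] at h ⊢
  | pair _ _ ih₁ ih₂ | comp _ _ ih₁ ih₂ | prec _ _ ih₁ ih₂ =>
    intro d h; cases d <;> simp [index, Nat.pair_eq_pair] at h ⊢
    exact ⟨ih₁ h.1, ih₂ h.2⟩
  | rfind _ ih =>
    intro d h; cases d <;> simp [index, Nat.pair_eq_pair] at h ⊢
    exact ih h

/-- A program for a constant function. -/
def const : ℕ → OracleCode
  | 0 => zero
  | n + 1 => comp succ (const n)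

theorem eval_const (g : ℕ → ℕ) (n a : ℕ) : (const n).eval g a = Part.some n := by
  induction n with
  | zero => rfl
  | succ n ih => simp [const, eval, ih]

/-- This is the only instance of the s-m-n theorem that is needed: hard-wiring an input n into a
program is primitive recursive in n. -/
theorem primrec_index_const : Primrec fun n => (const n).index := by
  refine (Primrec.nat_rec₁ (f := fun _ i => Nat.pair 6 (Nat.pair succ.index i)) zero.index
    ?_).of_eq fun n => ?_
  · exact (Primrec₂.natPair.comp (Primrec.const 6)
      (Primrec₂.natPair.comp (Primrec.const _) Primrec.snd)).to₂
  · induction n with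
    | zero => rfl
    | succ n ih => simp only [const, index, ← ih]

end OracleCode

/-! ## The Turing jump -/

theorem mem_turingJump_index {X : Set ℕ} (c : OracleCode) :
    c.index ∈ turingJump X ↔ (c.eval (charFun X) c.index).Dom :=
  ⟨fun ⟨_, h, hd⟩ => OracleCode.index_injective h ▸ hd, fun h => ⟨c, rfl, h⟩⟩

/-- The projection of a relation that is recursive in `X` is recursive in the jump of `X`. -/
theorem turingLE_turingJump_of_projection {R X : Set ℕ} (hR : TuringLE (charFun R) (charFun X)) :
    TuringLE (charFun {n | ∃ m, Nat.pair n m ∈ R}) (charFun (turingJump X)) := by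
  obtain ⟨c, hc⟩ := OracleCode.exists_code (TuringLE.partRecIn_search hR)
  have hs : Primrec fun n => (OracleCode.comp c (.const n)).index :=
    Primrec₂.natPair.comp (Primrec.const 6)
      (Primrec₂.natPair.comp (Primrec.const _) OracleCode.primrec_index_const)
  have key : charFun {n | ∃ m, Nat.pair n m ∈ R} =
      fun n => charFun (turingJump X) (OracleCode.comp c (.const n)).index := by
    funext n
    -- The program `comp c (const n)` ignores its input and searches for a partner of n, so it halts
    -- on its own index exactly when a partner exists.
    have : n ∈ {n | ∃ m, Nat.pair n m ∈ R} ↔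
        (OracleCode.comp c (.const n)).index ∈ turingJump X := by
      rw [mem_turingJump_index]
      simp only [OracleCode.eval, OracleCode.eval_const, hc]
      exact (Part.bind_some n (TuringLE.search R) ▸ TuringLE.search_dom).symm
    by_cases h : n ∈ {n | ∃ m, Nat.pair n m ∈ R}
    · rw [charFun_of_mem h, charFun_of_mem (this.1 h)]
    · rw [charFun_of_notMem h, charFun_of_notMem (mt this.2 h)]
  rw [key]
  exact (TuringLE.refl _).comp (.of_primrec hs)

/-- X is a projection of a relation recursive in X, with a dummy second coordinate. -/
theorem turingLE_turingJump (X : Set ℕ) : TuringLE (charFun X) (charFun (turingJump X)) := by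
  have h : TuringLE (charFun {p : ℕ | p.unpair.1 ∈ X}) (charFun X) :=
    (TuringLE.refl (charFun X)).comp (.of_primrec (Primrec.fst.comp Primrec.unpair))
  simpa using turingLE_turingJump_of_projection h

theorem zeroJump_succ (n : ℕ) : zeroJump (n + 1) = turingJump (zeroJump n) :=
  Function.iterate_succ_apply' _ _ _

theorem zeroJump_mono {m n : ℕ} (h : m ≤ n) :
    TuringLE (charFun (zeroJump m)) (charFun (zeroJump n)) := by
  induction h with
  | refl => exact .refl _
  | step _ ih => exact ih.trans (zeroJump_succ _ ▸ turingLE_turingJump _)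

/-! ## Computation records -/

/-- The number that codes the claim `Φ_e(a) = b`. -/
def claim (e a b : ℕ) : ℕ := Nat.pair e (Nat.pair a b)

/-- The claim `Φ_e^h(a) = b` follows in one step from the claims in `P`. -/
def Justified (h : ℕ → ℕ) (P : List ℕ) (e a b : ℕ) : Prop :=
  (e = Nat.pair 0 0 ∧ b = 0) ∨
  (e = Nat.pair 1 0 ∧ b = a + 1) ∨
  (e = Nat.pair 2 0 ∧ b = a.unpair.1) ∨
  (e = Nat.pair 3 0 ∧ b = a.unpair.2) ∨
  (e = Nat.pair 4 0 ∧ b = h a) ∨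
  (e.unpair.1 = 5 ∧ claim e.unpair.2.unpair.1 a b.unpair.1 ∈ P ∧
    claim e.unpair.2.unpair.2 a b.unpair.2 ∈ P) ∨
  (e.unpair.1 = 6 ∧ ∃ p ∈ P, (p.unpair.1 = e.unpair.2.unpair.2 ∧ p.unpair.2.unpair.1 = a) ∧
    claim e.unpair.2.unpair.1 p.unpair.2.unpair.2 b ∈ P) ∨
  (e.unpair.1 = 7 ∧ ((a.unpair.2 = 0 ∧ claim e.unpair.2.unpair.1 a.unpair.1 b ∈ P) ∨
    (a.unpair.2 ≠ 0 ∧ ∃ p ∈ P,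
      (p.unpair.1 = e ∧ p.unpair.2.unpair.1 = Nat.pair a.unpair.1 (a.unpair.2 - 1)) ∧
      claim e.unpair.2.unpair.2
        (Nat.pair a.unpair.1 (Nat.pair (a.unpair.2 - 1) p.unpair.2.unpair.2)) b ∈ P))) ∨
  (e.unpair.1 = 8 ∧ claim e.unpair.2 (Nat.pair a b) 0 ∈ P ∧
    ∀ m < b, ∃ p ∈ P, (p.unpair.1 = e.unpair.2 ∧ p.unpair.2.unpair.1 = Nat.pair a m) ∧
      p.unpair.2.unpair.2 ≠ 0)

/-- `L` is a list of claims each of which is justified by earlier ones. -/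
def IsRecord (h : ℕ → ℕ) (L : List ℕ) : Prop :=
  ∀ i < L.length, Justified h (L.take i) (L.getD i 0).unpair.1 (L.getD i 0).unpair.2.unpair.1
    (L.getD i 0).unpair.2.unpair.2

/-- The claim coded by `p` occurs in a record. -/
def Derivable (h : ℕ → ℕ) (p : ℕ) : Prop := ∃ L, IsRecord h L ∧ p ∈ L

/-- The available claims occur only positively. Hence records can be concatenated, and finitely many
derivable claims share one record. -/
theorem Justified.mono {h : ℕ → ℕ} {P Q : List ℕ} {e a b : ℕ} (hPQ : P ⊆ Q)
    (H : Justified h P e a b) : Justified h Q e a b := by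
  rcases H with H | H | H | H | H | ⟨H, h1, h2⟩ | ⟨H, p, hp, h1, h2⟩ |
    ⟨H, ⟨h1, h2⟩ | ⟨h1, p, hp, h2, h3⟩⟩ | ⟨H, h1, h2⟩
  · exact .inl H
  · exact .inr (.inl H)
  · exact .inr (.inr (.inl H))
  · exact .inr (.inr (.inr (.inl H)))
  · exact .inr (.inr (.inr (.inr (.inl H))))
  · exact .inr (.inr (.inr (.inr (.inr (.inl ⟨H, hPQ h1, hPQ h2⟩)))))
  · exact .inr (.inr (.inr (.inr (.inr (.inr (.inl ⟨H, p, hPQ hp, h1, hPQ h2⟩))))))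
  · exact .inr (.inr (.inr (.inr (.inr (.inr (.inr (.inl ⟨H, .inl ⟨h1, hPQ h2⟩⟩)))))))
  · exact .inr (.inr (.inr (.inr (.inr (.inr (.inr
      (.inl ⟨H, .inr ⟨h1, p, hPQ hp, h2, hPQ h3⟩⟩)))))))
  · refine .inr (.inr (.inr (.inr (.inr (.inr (.inr (.inr ⟨H, hPQ h1, fun m hm => ?_⟩)))))))
    obtain ⟨p, hp, h3⟩ := h2 m hm
    exact ⟨p, hPQ hp, h3⟩

/-- A single step asks the oracle at most about its own input a. A record therefore depends on the
oracle only at the inputs of the claims it lists, which is the source of all use bounds below. -/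
theorem Justified.congr_oracle {h h' : ℕ → ℕ} {P : List ℕ} {e a b : ℕ} (hh : h a = h' a)
    (H : Justified h P e a b) : Justified h' P e a b := by
  unfold Justified at *
  rwa [← hh]

theorem IsRecord.congr_oracle {h h' : ℕ → ℕ} {L : List ℕ} (H : IsRecord h L)
    (hh : ∀ p ∈ L, h p.unpair.2.unpair.1 = h' p.unpair.2.unpair.1) : IsRecord h' L := by
  intro i hi
  refine (H i hi).congr_oracle (hh _ ?_)
  rw [List.getD_eq_getElem _ _ hi]
  exact List.getElem_mem hi

theorem IsRecord.nil {h : ℕ → ℕ} : IsRecord h [] := by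
  intro i hi; simp at hi

theorem IsRecord.append {h : ℕ → ℕ} {L M : List ℕ} (hL : IsRecord h L) (hM : IsRecord h M) :
    IsRecord h (L ++ M) := by
  intro i hi
  by_cases hi' : i < L.length
  · rw [List.getD_append _ _ _ _ hi', List.take_append_of_le_length hi'.le]
    exact hL i hi'
  · push Not at hi'
    obtain ⟨j, rfl⟩ := Nat.exists_eq_add_of_le hi'
    rw [List.getD_append_right _ _ _ _ hi', Nat.add_sub_cancel_left, List.take_length_add_append]
    exact (hM j (by simpa using hi)).mono (List.subset_append_right _ _)

theorem IsRecord.concat {h : ℕ → ℕ} {L : List ℕ} {e a b : ℕ} (hL : IsRecord h L)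
    (H : Justified h L e a b) : IsRecord h (L ++ [claim e a b]) := by
  intro i hi
  rcases Nat.lt_succ_iff_lt_or_eq.1 (by simpa using hi : i < L.length + 1) with hi' | rfl
  · rw [List.getD_append _ _ _ _ hi', List.take_append_of_le_length hi'.le]
    exact hL i hi'
  · simpa [claim] using H

theorem exists_record_of_derivable {h : ℕ → ℕ} (Q : List ℕ) (hQ : ∀ q ∈ Q, Derivable h q) :
    ∃ L, IsRecord h L ∧ Q ⊆ L := by
  induction Q with
  | nil => exact ⟨[], .nil, by simp⟩
  | cons q Q ih =>
    obtain ⟨L, hL, hQL⟩ := ih fun p hp => hQ p (by simp [hp])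
    obtain ⟨M, hM, hqM⟩ := hQ q (by simp)
    refine ⟨L ++ M, hL.append hM, ?_⟩
    simp only [List.cons_subset, List.mem_append, hqM, or_true, true_and]
    exact fun p hp => List.mem_append_left _ (hQL hp)

theorem Derivable.of_justified {h : ℕ → ℕ} (Q : List ℕ) {e a b : ℕ} (hQ : ∀ q ∈ Q, Derivable h q)
    (H : Justified h Q e a b) : Derivable h (claim e a b) := by
  obtain ⟨L, hL, hQL⟩ := exists_record_of_derivable Q hQ
  exact ⟨_, hL.concat (H.mono hQL), by simp⟩

/-- Every convergent computation has a record. -/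
theorem derivable_of_mem_eval {h : ℕ → ℕ} (c : OracleCode) :
    ∀ {a b : ℕ}, b ∈ c.eval h a → Derivable h (claim c.index a b) := by
  induction c with
  | zero =>
    intro a b hb
    have : b = 0 := by simpa [OracleCode.eval] using hb
    exact .of_justified [] (by simp) (.inl ⟨rfl, this⟩)
  | succ =>
    intro a b hb
    have : b = a + 1 := by simpa [OracleCode.eval] using hb
    exact .of_justified [] (by simp) (.inr (.inl ⟨rfl, this⟩))
  | left =>
    intro a b hb
    have : b = a.unpair.1 := by simpa [OracleCode.eval] using hb
    exact .of_justified [] (by simp) (.inr (.inr (.inl ⟨rfl, this⟩)))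
  | right =>
    intro a b hb
    have : b = a.unpair.2 := by simpa [OracleCode.eval] using hb
    exact .of_justified [] (by simp) (.inr (.inr (.inr (.inl ⟨rfl, this⟩))))
  | oracle =>
    intro a b hb
    have : b = h a := by simpa [OracleCode.eval] using hb
    exact .of_justified [] (by simp) (.inr (.inr (.inr (.inr (.inl ⟨rfl, this⟩)))))
  | pair c d ihc ihd =>
    intro a b hb
    obtain ⟨u, hu, w, hw, rfl⟩ : ∃ u ∈ c.eval h a, ∃ w ∈ d.eval h a, Nat.pair u w = b := by
      simpa [OracleCode.eval, Seq.seq] using hb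
    refine .of_justified [claim c.index a u, claim d.index a w] (by simp [ihc hu, ihd hw]) ?_
    exact .inr (.inr (.inr (.inr (.inr (.inl (by simp [OracleCode.index]))))))
  | comp c d ihc ihd =>
    intro a b hb
    obtain ⟨u, hu, hb⟩ : ∃ u ∈ d.eval h a, b ∈ c.eval h u :=
      Part.mem_bind_iff.1 hb
    refine .of_justified [claim d.index a u, claim c.index u b] (by simp [ihc hb, ihd hu]) ?_
    refine .inr (.inr (.inr (.inr (.inr (.inr (.inl ⟨by simp [OracleCode.index],
      claim d.index a u, by simp, ?_⟩))))))
    simp [OracleCode.index, claim]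
  | prec c d ihc ihd =>
    intro a b hb
    obtain ⟨x, n, rfl⟩ : ∃ x n, a = Nat.pair x n := ⟨_, _, (Nat.pair_unpair a).symm⟩
    simp only [OracleCode.eval, Nat.unpair_pair] at hb
    -- An inner induction on the recursion argument: the value at n + 1 rests on a claim about the
    -- same program at n, which the induction on programs does not provide.
    induction n generalizing b with
    | zero =>
      refine .of_justified [claim c.index x b] (by simpa using ihc hb) ?_
      exact .inr (.inr (.inr (.inr (.inr (.inr (.inr (.inl (by simp [OracleCode.index]))))))))
    | succ n ih =>
      obtain ⟨u, hu, hb⟩ := Part.mem_bind_iff.1 hb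
      refine .of_justified [claim (OracleCode.prec c d).index (Nat.pair x n) u,
        claim d.index (Nat.pair x (Nat.pair n u)) b] (by simp [ih hu, ihd hb]) ?_
      refine .inr (.inr (.inr (.inr (.inr (.inr (.inr (.inl ⟨by simp [OracleCode.index],
        .inr ⟨by simp, claim (OracleCode.prec c d).index (Nat.pair x n) u, by simp, ?_⟩⟩)))))))
      simp [OracleCode.index, claim]
  | rfind c ih =>
    intro a b hb
    have hb' : (0 ∈ c.eval h (Nat.pair a b)) ∧ ∀ m < b, ∃ u, u ≠ 0 ∧ u ∈ c.eval h (Nat.pair a m) := by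
      obtain ⟨h1, h2⟩ := Nat.mem_rfind.1 hb
      refine ⟨by simpa using h1, fun m hm => ?_⟩
      simpa [and_comm] using h2 hm
    choose! f hf using hb'.2
    refine .of_justified (claim c.index (Nat.pair a b) 0 ::
      (List.range b).map fun m => claim c.index (Nat.pair a m) (f m)) ?_ ?_
    · simp only [List.mem_cons, List.mem_map, List.mem_range]
      rintro q (rfl | ⟨m, hm, rfl⟩)
      · exact ih hb'.1
      · exact ih (hf m hm).2
    · refine .inr (.inr (.inr (.inr (.inr (.inr (.inr (.inr ⟨by simp [OracleCode.index], ?_,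
        fun m hm => ⟨claim c.index (Nat.pair a m) (f m), ?_, ?_⟩⟩)))))))
      · simp [OracleCode.index]
      · simp only [List.mem_cons, List.mem_map, List.mem_range]
        exact .inr ⟨m, hm, rfl⟩
      · simp [OracleCode.index, claim, (hf m hm).1]

/-- If claims about programs in `P` are true, so are the claims about programs that they
justify. -/
theorem Justified.sound {h : ℕ → ℕ} {P : List ℕ} {c : OracleCode} {a b : ℕ}
    (hP : ∀ (d : OracleCode) (x y : ℕ), claim d.index x y ∈ P → y ∈ d.eval h x)
    (H : Justified h P c.index a b) : b ∈ c.eval h a := by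
  have hP' : ∀ (d : OracleCode), ∀ p ∈ P, p.unpair.1 = d.index →
      p.unpair.2.unpair.2 ∈ d.eval h p.unpair.2.unpair.1 := by
    intro d p hp hpd
    exact hP _ _ _ (by rw [claim, Nat.pair_unpair, ← hpd, Nat.pair_unpair]; exact hp)
  cases c with
  | zero | succ | left | right | oracle =>
    simpa [Justified, OracleCode.index, OracleCode.eval, Nat.pair_eq_pair] using H
  | pair c d =>
    simp only [Justified, OracleCode.index, Nat.pair_eq_pair, Nat.unpair_pair] at H
    norm_num at H
    have h1 := hP _ _ _ H.1
    have h2 := hP _ _ _ H.2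
    simp only [OracleCode.eval, Seq.seq, Part.map_eq_map, Part.mem_bind_iff,
      Part.mem_map_iff]
    exact ⟨_, ⟨_, h1, rfl⟩, _, h2, Nat.pair_unpair b⟩
  | comp c d =>
    simp only [Justified, OracleCode.index, Nat.pair_eq_pair, Nat.unpair_pair] at H
    norm_num at H
    obtain ⟨p, hp, ⟨h1, rfl⟩, h2⟩ := H
    exact Part.mem_bind_iff.2 ⟨_, hP' d p hp h1, hP _ _ _ h2⟩
  | prec c d =>
    have hprec := hP' (.prec c d)
    simp only [Justified, OracleCode.index, Nat.pair_eq_pair, Nat.unpair_pair] at H hprec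
    norm_num at H
    obtain ⟨x, n, rfl⟩ : ∃ x n, a = Nat.pair x n := ⟨_, _, (Nat.pair_unpair a).symm⟩
    simp only [Nat.unpair_pair] at H
    rcases H with ⟨rfl, H⟩ | ⟨hn, p, hp, ⟨h1, h2⟩, h3⟩
    · simpa [OracleCode.eval] using hP _ _ _ H
    · obtain ⟨n, rfl⟩ := Nat.exists_eq_succ_of_ne_zero hn
      have := hprec p hp h1
      rw [h2] at this
      simp only [OracleCode.eval, Nat.unpair_pair, Nat.succ_sub_one] at this h3 ⊢
      exact Part.mem_bind_iff.2 ⟨_, this, hP _ _ _ h3⟩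
  | rfind c =>
    simp only [Justified, OracleCode.index, Nat.pair_eq_pair, Nat.unpair_pair] at H
    norm_num at H
    refine Nat.mem_rfind.2 ⟨by simpa using hP _ _ _ H.1, fun {m} hm => ?_⟩
    obtain ⟨p, hp, ⟨h1, h2⟩, h3⟩ := H.2 m hm
    have := hP' c p hp h1
    rw [h2] at this
    simpa using ⟨_, this, h3⟩

theorem IsRecord.sound {h : ℕ → ℕ} {L : List ℕ} (hL : IsRecord h L) {c : OracleCode} {a b : ℕ}
    (hm : claim c.index a b ∈ L) : b ∈ c.eval h a := by
  -- Induction on initial segments: the last claim is justified by the preceding ones, which are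
  -- already known to be true.
  have key : ∀ n, ∀ (c : OracleCode) (a b : ℕ), claim c.index a b ∈ L.take n → b ∈ c.eval h a := by
    intro n
    induction n with
    | zero => intro c a b hm; simp at hm
    | succ n ih =>
      intro c a b hm
      by_cases hn : n < L.length
      · rw [List.take_succ_eq_append_getElem hn, List.mem_append, List.mem_singleton] at hm
        rcases hm with hm | hm
        · exact ih c a b hm
        · have := hL n hn
          rw [List.getD_eq_getElem _ _ hn, ← hm] at this
          simp only [claim, Nat.unpair_pair] at this
          exact this.sound ih
      · rw [List.take_of_length_le (by omega)] at hm
        exact ih c a b (by rwa [List.take_of_length_le (by omega)])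
  exact key L.length c a b (by simpa using hm)

/-! ### Primitive recursiveness of the record predicate -/

section

variable {α : Type*} [Primcodable α]

theorem PrimrecPred.of_exists_mem {L : α → List ℕ} {R : ℕ → α → Prop} (hL : Primrec L)
    (hR : PrimrecPred fun y : ℕ × α => R y.1 y.2) : PrimrecPred fun x => ∃ p ∈ L x, R p x :=
  PrimrecRel.comp (PrimrecRel.exists_mem_list (PrimrecPred.primrecRel hR)) hL Primrec.id

theorem PrimrecPred.of_forall_lt {u : α → ℕ} {R : ℕ → α → Prop} (hu : Primrec u)
    (hR : PrimrecPred fun y : ℕ × α => R y.1 y.2) : PrimrecPred fun x => ∀ m < u x, R m x :=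
  (PrimrecRel.comp (PrimrecRel.forall_mem_list (PrimrecPred.primrecRel hR))
    (Primrec.list_range.comp hu) Primrec.id).of_eq (by simp)

theorem PrimrecPred.of_mem {L : α → List ℕ} {f : α → ℕ} (hL : Primrec L) (hf : Primrec f) :
    PrimrecPred fun x => f x ∈ L x :=
  (PrimrecPred.of_exists_mem (R := fun p x => p = f x) hL
    (Primrec.eq.comp Primrec.fst (hf.comp Primrec.snd))).of_eq (by simp)

theorem Primrec.unpair_fst {f : α → ℕ} (hf : Primrec f) : Primrec fun x => (f x).unpair.1 :=
  Primrec.fst.comp (Primrec.unpair.comp hf)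

theorem Primrec.unpair_snd {f : α → ℕ} (hf : Primrec f) : Primrec fun x => (f x).unpair.2 :=
  Primrec.snd.comp (Primrec.unpair.comp hf)

theorem Primrec.natPair {f g : α → ℕ} (hf : Primrec f) (hg : Primrec g) :
    Primrec fun x => Nat.pair (f x) (g x) :=
  Primrec₂.natPair.comp hf hg

theorem Primrec.claim {f g h : α → ℕ} (hf : Primrec f) (hg : Primrec g) (hh : Primrec h) :
    Primrec fun x => claim (f x) (g x) (h x) :=
  .natPair hf (.natPair hg hh)

theorem primrecPred_justified {O P : α → List ℕ} {e a b : α → ℕ} (hO : Primrec O) (hP : Primrec P)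
    (he : Primrec e) (ha : Primrec a) (hb : Primrec b) :
    PrimrecPred fun x => Justified (fun i => (O x).getD i 0) (P x) (e x) (a x) (b x) := by
  have heq : ∀ {β : Type _} [Primcodable β] {f g : β → ℕ}, Primrec f → Primrec g →
    PrimrecPred fun x => f x = g x := fun hf hg => Primrec.eq.comp hf hg
  have hc : ∀ {β : Type _} [Primcodable β] (n : ℕ), Primrec fun _ : β => n := Primrec.const
  have s : ∀ {f : α → ℕ}, Primrec f → Primrec fun y : ℕ × α => f y.2 :=
    fun hf => hf.comp Primrec.snd
  have sP := hP.comp (Primrec.snd : Primrec fun y : ℕ × α => y.2)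
  have p : Primrec fun y : ℕ × α => y.1 := Primrec.fst
  have hpred : Primrec fun x => (a x).unpair.2 - 1 := Primrec.nat_sub.comp ha.unpair_snd (hc 1)
  unfold Justified
  refine .or ?_ <| .or ?_ <| .or ?_ <| .or ?_ <| .or ?_ <| .or ?_ <| .or ?_ <| .or ?_ ?_
  · exact .and (heq he (hc _)) (heq hb (hc _))
  · exact .and (heq he (hc _)) (heq hb (Primrec.succ.comp ha))
  · exact .and (heq he (hc _)) (heq hb ha.unpair_fst)
  · exact .and (heq he (hc _)) (heq hb ha.unpair_snd)
  · exact .and (heq he (hc _)) (heq hb ((Primrec.list_getD 0).comp hO ha))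
  · exact .and (heq he.unpair_fst (hc 5))
      (.and (.of_mem hP (.claim he.unpair_snd.unpair_fst ha hb.unpair_fst))
        (.of_mem hP (.claim he.unpair_snd.unpair_snd ha hb.unpair_snd)))
  · refine .and (heq he.unpair_fst (hc 6)) (.of_exists_mem hP ?_)
    exact .and (.and (heq p.unpair_fst (s he.unpair_snd.unpair_snd))
      (heq p.unpair_snd.unpair_fst (s ha)))
      (.of_mem sP (.claim (s he.unpair_snd.unpair_fst) p.unpair_snd.unpair_snd (s hb)))
  · refine .and (heq he.unpair_fst (hc 7)) (.or (.and (heq ha.unpair_snd (hc 0))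
      (.of_mem hP (.claim he.unpair_snd.unpair_fst ha.unpair_fst hb)))
      (.and (PrimrecPred.not (heq ha.unpair_snd (hc 0)))
        (.of_exists_mem hP ?_)))
    exact .and (.and (heq p.unpair_fst (s he))
      (heq p.unpair_snd.unpair_fst (s (.natPair ha.unpair_fst hpred))))
      (.of_mem sP (.claim (s he.unpair_snd.unpair_snd)
        (.natPair (s ha.unpair_fst) (.natPair (s hpred) p.unpair_snd.unpair_snd)) (s hb)))
  · refine .and (heq he.unpair_fst (hc 8)) (.and
      (.of_mem hP (.claim he.unpair_snd (.natPair ha hb) (hc 0)))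
      (.of_forall_lt hb (.of_exists_mem sP ?_)))
    have q : Primrec fun y : ℕ × ℕ × α => y.1 := Primrec.fst
    have m : Primrec fun y : ℕ × ℕ × α => y.2.1 := Primrec.fst.comp Primrec.snd
    have t : Primrec fun y : ℕ × ℕ × α => y.2.2 := Primrec.snd.comp Primrec.snd
    exact .and (.and (heq q.unpair_fst (he.unpair_snd.comp t))
      (heq q.unpair_snd.unpair_fst (.natPair (ha.comp t) m)))
      (PrimrecPred.not (heq q.unpair_snd.unpair_snd (hc 0)))

theorem primrecPred_isRecord {O L : α → List ℕ} (hO : Primrec O) (hL : Primrec L) :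
    PrimrecPred fun x => IsRecord (fun i => (O x).getD i 0) (L x) := by
  unfold IsRecord
  refine .of_forall_lt (Primrec.list_length.comp hL) ?_
  have sL := hL.comp (Primrec.snd : Primrec fun y : ℕ × α => y.2)
  have sO := hO.comp (Primrec.snd : Primrec fun y : ℕ × α => y.2)
  have p : Primrec fun y : ℕ × α => (L y.2).getD y.1 0 :=
    (Primrec.list_getD 0).comp sL Primrec.fst
  exact primrecPred_justified sO (Primrec.list_take.comp Primrec.fst sL) p.unpair_fst
    p.unpair_snd.unpair_fst p.unpair_snd.unpair_snd

end

/-! ## Indices of programs form a primitive recursive set -/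

open Classical in
/-- The characteristic function of the set of indices. -/
noncomputable def isIndex (n : ℕ) : Bool := decide (∃ c : OracleCode, c.index = n)

theorem isIndex_eq_true {n : ℕ} : isIndex n = true ↔ ∃ c : OracleCode, c.index = n := by
  simp [isIndex]

/-- The recursion step for `isIndex`. -/
def isIndexStep (l : List Bool) (n : ℕ) : Bool :=
  (decide (n.unpair.1 < 5) && decide (n.unpair.2 = 0)) ||
  ((decide (5 ≤ n.unpair.1) && decide (n.unpair.1 < 8)) &&
    (l.getD n.unpair.2.unpair.1 false && l.getD n.unpair.2.unpair.2 false)) ||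
  (decide (n.unpair.1 = 8) && l.getD n.unpair.2 false)

theorem unpair_snd_lt {n : ℕ} (h : n.unpair.1 ≠ 0) : n.unpair.2 < n := by
  have : ∀ a b, a ≠ 0 → b < Nat.pair a b := by
    intro a b ha
    unfold Nat.pair
    split <;> nlinarith [Nat.pos_of_ne_zero ha]
  simpa using this n.unpair.1 n.unpair.2 h

/-- A composite index has a nonzero tag, so the indices of its parts are smaller than n. The list of
earlier values thus contains every entry that matters, and the default `false` has no influence. -/
theorem isIndexStep_map_range (n : ℕ) : isIndexStep ((List.range n).map isIndex) n = isIndex n := by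
  have hget : ∀ k < n, ((List.range n).map isIndex).getD k false = isIndex k := by
    intro k hk
    simp [List.getD, hk]
  rw [Bool.eq_iff_iff, isIndex_eq_true]
  obtain ⟨t, q, rfl⟩ : ∃ t q, n = Nat.pair t q := ⟨_, _, (Nat.pair_unpair n).symm⟩
  have hq : t ≠ 0 → q < Nat.pair t q := by simpa using unpair_snd_lt (n := Nat.pair t q)
  have h1 := Nat.unpair_left_le q
  have h2 := Nat.unpair_right_le q
  simp only [isIndexStep, Nat.unpair_pair, Bool.or_eq_true, Bool.and_eq_true, decide_eq_true_eq]
  constructor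
  · rintro ((⟨ht, rfl⟩ | ⟨⟨ht, ht'⟩, h3, h4⟩) | ⟨rfl, h3⟩)
    · interval_cases t
      exacts [⟨.zero, rfl⟩, ⟨.succ, rfl⟩, ⟨.left, rfl⟩, ⟨.right, rfl⟩, ⟨.oracle, rfl⟩]
    · rw [hget _ (by have := hq (by omega); omega), isIndex_eq_true] at h3 h4
      obtain ⟨c, hc⟩ := h3
      obtain ⟨d, hd⟩ := h4
      have : q = Nat.pair c.index d.index := by rw [hc, hd, Nat.pair_unpair]
      interval_cases t
      exacts [⟨.pair c d, by simp [OracleCode.index, this]⟩,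
        ⟨.comp c d, by simp [OracleCode.index, this]⟩, ⟨.prec c d, by simp [OracleCode.index, this]⟩]
    · rw [hget _ (hq (by omega)), isIndex_eq_true] at h3
      obtain ⟨c, rfl⟩ := h3
      exact ⟨.rfind c, rfl⟩
  · rintro ⟨c, hc⟩
    cases c with
    | zero | succ | left | right | oracle =>
      obtain ⟨rfl, rfl⟩ := Nat.pair_eq_pair.1 hc
      simp
    | pair c d | comp c d | prec c d =>
      obtain ⟨rfl, rfl⟩ := Nat.pair_eq_pair.1 hc
      have := hq (by omega)
      rw [hget _ (by omega), hget _ (by omega), isIndex_eq_true, isIndex_eq_true]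
      exact .inl (.inr ⟨by omega, ⟨c, by simp⟩, d, by simp⟩)
    | rfind c =>
      obtain ⟨rfl, rfl⟩ := Nat.pair_eq_pair.1 hc
      rw [hget _ (hq (by omega)), isIndex_eq_true]
      exact .inr ⟨rfl, c, rfl⟩

/-- Course-of-values recursion, with n recovered as the length of the list of earlier values. A
separate test for indices is needed because records do not provide one: a claim about `Nat.pair 7
(Nat.pair c q)` with recursion argument 0 is justified without any look at q. -/
theorem primrec_isIndex : Primrec isIndex := by
  have hstep : Primrec₂ fun (_ : Unit) (l : List Bool) => some (isIndexStep l l.length) := by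
    suffices h : Primrec fun x : Unit × List Bool => isIndexStep x.2 x.2.length from
      (Primrec.option_some.comp h).to₂
    have hl : Primrec fun x : Unit × List Bool => x.2 := Primrec.snd
    have hn : Primrec fun x : Unit × List Bool => x.2.length := Primrec.list_length.comp hl
    have hd : ∀ {f : Unit × List Bool → ℕ}, Primrec f →
        Primrec fun x : Unit × List Bool => x.2.getD (f x) false :=
      fun hf => (Primrec.list_getD false).comp hl hf
    refine Primrec.or.comp (Primrec.or.comp (Primrec.and.comp ?_ ?_)
      (Primrec.and.comp (Primrec.and.comp ?_ ?_) (Primrec.and.comp ?_ ?_))) (Primrec.and.comp ?_ ?_)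
    · exact (PrimrecRel.comp Primrec.nat_lt hn.unpair_fst (.const 5)).decide
    · exact (PrimrecRel.comp Primrec.eq hn.unpair_snd (.const 0)).decide
    · exact (PrimrecRel.comp Primrec.nat_le (.const 5) hn.unpair_fst).decide
    · exact (PrimrecRel.comp Primrec.nat_lt hn.unpair_fst (.const 8)).decide
    · exact hd hn.unpair_snd.unpair_fst
    · exact hd hn.unpair_snd.unpair_snd
    · exact (PrimrecRel.comp Primrec.eq hn.unpair_fst (.const 8)).decide
    · exact hd hn.unpair_snd
  exact (Primrec.nat_strong_rec (fun (_ : Unit) n => isIndex n) hstep fun _ n => by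
    simp [isIndexStep_map_range]).comp (Primrec.const ()) Primrec.id

/-! ## Coding of finite sequences by numbers -/

/-- The sequence coded by `s` by means of Gödel's `β` function. -/
def seqOf (s : ℕ) : List ℕ := (List.range s.unpair.1).map (Nat.beta s.unpair.2)

theorem length_seqOf (s : ℕ) : (seqOf s).length = s.unpair.1 := by simp [seqOf]

theorem seqOf_surjective : Function.Surjective seqOf := by
  intro l
  refine ⟨Nat.pair l.length (Nat.unbeta l), List.ext_getElem (by simp [seqOf]) fun i _ hi => ?_⟩
  simpa [seqOf] using Nat.beta_unbeta_coe l ⟨i, hi⟩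

/-- Entries are remainders of a component of s. The code of a record consequently bounds every
oracle question asked in it. -/
theorem le_of_mem_seqOf {s x : ℕ} (h : x ∈ seqOf s) : x ≤ s := by
  obtain ⟨i, -, rfl⟩ := List.mem_map.1 h
  exact (Nat.mod_le _ _).trans ((Nat.unpair_left_le _).trans (Nat.unpair_right_le _))

theorem primrec_seqOf : Primrec seqOf := by
  have hs : Primrec fun x : ℕ × ℕ => x.1.unpair.2 := Primrec.fst.unpair_snd
  refine Primrec.list_map (Primrec.list_range.comp Primrec.id.unpair_fst) ?_
  show Primrec fun x : ℕ × ℕ => Nat.beta x.1.unpair.2 x.2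
  exact Primrec.nat_mod.comp hs.unpair_fst (Primrec.succ.comp (Primrec.nat_mul.comp
    (Primrec.succ.comp Primrec.snd) hs.unpair_snd))

/-! ## Witnesses for membership in the jump -/

/-- `d` codes a record which shows that the `e`-th program with oracle `h` halts on input `e`. -/
def JumpWitness (h : ℕ → ℕ) (e d : ℕ) : Prop :=
  isIndex e = true ∧ IsRecord h (seqOf d) ∧
    ∃ p ∈ seqOf d, p.unpair.1 = e ∧ p.unpair.2.unpair.1 = e

/-- Completeness of records gives one direction and soundness the other. Membership in the jump
thereby acquires numerical witnesses that can be checked primitive recursively from finitely many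
oracle values. -/
theorem mem_turingJump_iff {X : Set ℕ} {e : ℕ} :
    e ∈ turingJump X ↔ ∃ d, JumpWitness (charFun X) e d := by
  constructor
  · rintro ⟨c, rfl, hc⟩
    obtain ⟨b, hb⟩ := Part.dom_iff_mem.1 hc
    obtain ⟨L, hL, hm⟩ := derivable_of_mem_eval c hb
    obtain ⟨d, rfl⟩ := seqOf_surjective L
    exact ⟨d, isIndex_eq_true.2 ⟨c, rfl⟩, hL, _, hm, by simp [claim]⟩
  · rintro ⟨d, hi, hd, p, hp, h1, h2⟩
    obtain ⟨c, rfl⟩ := isIndex_eq_true.1 hi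
    have : claim c.index c.index p.unpair.2.unpair.2 = p := by
      rw [claim]
      nth_rw 1 [← h1]
      nth_rw 1 [← h2]
      simp
    exact ⟨c, rfl, Part.dom_iff_mem.2 ⟨_, hd.sound (this.symm ▸ hp)⟩⟩

/-- The input of a claim is at most the claim, which is at most the code d of the record. -/
theorem JumpWitness.congr_oracle {h h' : ℕ → ℕ} {e d : ℕ} (hh : ∀ a ≤ d, h a = h' a)
    (H : JumpWitness h e d) : JumpWitness h' e d :=
  ⟨H.1, H.2.1.congr_oracle fun _ hp => hh _ ((Nat.unpair_left_le _).trans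
    ((Nat.unpair_right_le _).trans (le_of_mem_seqOf hp))), H.2.2⟩

theorem jumpWitness_congr {h h' : ℕ → ℕ} {e d : ℕ} (hh : ∀ a ≤ d, h a = h' a) :
    JumpWitness h e d ↔ JumpWitness h' e d :=
  ⟨.congr_oracle hh, .congr_oracle fun a ha => (hh a ha).symm⟩

theorem primrecPred_jumpWitness {α : Type*} [Primcodable α] {O : α → List ℕ} {e d : α → ℕ}
    (hO : Primrec O) (he : Primrec e) (hd : Primrec d) :
    PrimrecPred fun x => JumpWitness (fun i => (O x).getD i 0) (e x) (d x) := by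
  have hs := primrec_seqOf.comp hd
  have p : Primrec fun y : ℕ × α => y.1 := Primrec.fst
  have e' : Primrec fun y : ℕ × α => e y.2 := he.comp Primrec.snd
  refine .and (Primrec.eq.comp (primrec_isIndex.comp he) (.const true))
    (.and (primrecPred_isRecord hO hs) (.of_exists_mem hs
      (.and (Primrec.eq.comp p.unpair_fst e') (Primrec.eq.comp p.unpair_snd.unpair_fst e'))))

/-! ## Sets recursive in an oracle -/

namespace TuringLE

variable {A B : Set ℕ} {f g : ℕ → ℕ}

theorem charFun_compl (hA : TuringLE (charFun A) g) : TuringLE (charFun Aᶜ) g := by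
  have : charFun Aᶜ = fun n => 1 - charFun A n := by
    funext n
    by_cases h : n ∈ A <;> simp [charFun, h]
  rw [this]
  exact computable₂_comp (F := fun a b : ℕ => a - b) Primrec.nat_sub.to_comp
    (of_primrec (Primrec.const 1)) hA

theorem charFun_inter (hA : TuringLE (charFun A) g) (hB : TuringLE (charFun B) g) :
    TuringLE (charFun (A ∩ B)) g := by
  have : charFun (A ∩ B) = fun n => charFun A n * charFun B n := by
    funext n
    by_cases h : n ∈ A <;> by_cases h' : n ∈ B <;> simp [charFun, h, h']
  rw [this]
  exact computable₂_comp (F := fun a b : ℕ => a * b) Primrec.nat_mul.to_comp hA hB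

theorem charFun_union (hA : TuringLE (charFun A) g) (hB : TuringLE (charFun B) g) :
    TuringLE (charFun (A ∪ B)) g := by
  rw [show A ∪ B = (Aᶜ ∩ Bᶜ)ᶜ by simp [Set.compl_inter]]
  exact (hA.charFun_compl.charFun_inter hB.charFun_compl).charFun_compl

theorem charFun_preimage (hA : TuringLE (charFun A) g) (hf : TuringLE f g) :
    TuringLE (charFun {n | f n ∈ A}) g :=
  hA.comp hf

theorem charFun_of_primrecPred {p : ℕ → Prop} (hp : PrimrecPred p) :
    TuringLE (charFun {n | p n}) g := by
  classical
  have : charFun {n | p n} = fun n => if p n then 1 else 0 := by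
    funext n
    simp [charFun]
  rw [this]
  exact of_primrec (Primrec.ite hp (.const 1) (.const 0))

theorem charFun_of_bounded_use {p : List ℕ × ℕ → Prop} {u : ℕ → ℕ} (hp : PrimrecPred p)
    (hu : Primrec u) (g : ℕ → ℕ) :
    TuringLE (charFun {n | p ((List.range (u n)).map g, n)}) g := by
  classical
  have : charFun {n | p ((List.range (u n)).map g, n)} =
      fun n => if p ((List.range (u n)).map g, n) then 1 else 0 := by
    funext n
    simp [charFun]
  rw [this]
  exact of_bounded_use (F := fun l n => if p (l, n) then 1 else 0)
    (Primrec.ite hp (.const 1) (.const 0)).to_comp hu.to_comp g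

end TuringLE

theorem getD_map_range (x : ℕ → ℕ) {i n : ℕ} (h : i < n) :
    ((List.range n).map x).getD i 0 = x i := by
  simp [List.getD, h]

theorem turingLE_charFun_jumpWitness (h : ℕ → ℕ) :
    TuringLE (charFun {p : ℕ | JumpWitness h p.unpair.1 p.unpair.2}) h := by
  have := TuringLE.charFun_of_bounded_use (p := fun q : List ℕ × ℕ =>
    JumpWitness (fun i => q.1.getD i 0) q.2.unpair.1 q.2.unpair.2)
    (u := fun p => p.unpair.2 + 1) (primrecPred_jumpWitness Primrec.fst
      Primrec.snd.unpair_fst Primrec.snd.unpair_snd) (Primrec.succ.comp Primrec.id.unpair_snd) h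
  convert this using 3
  ext p
  exact jumpWitness_congr fun a ha => (getD_map_range h (Nat.lt_succ_of_le ha)).symm

/-! ## Generators of the degrees of the finite jumps -/

open Classical in
/-- One plus the least witness for `e ∈ ∅⁽ᵏ⁾`, or `0` if there is none. -/
noncomputable def jumpStage : ℕ → ℕ → ℕ
  | 0, _ => 0
  | k + 1, e => if h : ∃ d, JumpWitness (charFun (zeroJump k)) e d then Nat.find h + 1 else 0

/-- The real whose first `n + 1` columns are the functions `jumpStage k` with `k ≤ n`. -/
noncomputable def jumpPath (n p : ℕ) : ℕ :=
  if p.unpair.1 ≤ n then jumpStage p.unpair.1 p.unpair.2 else 0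

theorem jumpStage_ne_zero {k e : ℕ} : jumpStage k e ≠ 0 ↔ e ∈ zeroJump k := by
  cases k with
  | zero => simp [jumpStage, zeroJump]
  | succ k => simp [jumpStage, zeroJump_succ, mem_turingJump_iff]

/-- The first clause forces v to be nonzero once there is a witness, and v - 1 to lie below every
witness; the second makes v - 1 a witness when v is nonzero. Each instance d is decided by oracle
values up to d, so a wrong v is refuted at a finite stage. -/
theorem jumpStage_succ_eq_iff {k e v : ℕ} : jumpStage (k + 1) e = v ↔
    ∀ d, (JumpWitness (charFun (zeroJump k)) e d → 0 < v ∧ v ≤ d + 1) ∧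
      (v = d + 1 → JumpWitness (charFun (zeroJump k)) e d) := by
  classical
  by_cases h : ∃ d, JumpWitness (charFun (zeroJump k)) e d
  · simp only [jumpStage, h, dite_true]
    constructor
    · rintro rfl d
      refine ⟨fun hd => ⟨by omega, Nat.succ_le_succ (Nat.find_min' h hd)⟩, fun hd => ?_⟩
      rw [← Nat.succ_injective hd]
      exact Nat.find_spec h
    · intro H
      have h1 := (H _).1 (Nat.find_spec h)
      obtain ⟨d, rfl⟩ := Nat.exists_eq_succ_of_ne_zero h1.1.ne'
      have := Nat.find_min' h ((H d).2 rfl)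
      have := h1.2
      omega
  · simp only [jumpStage, h, dite_false]
    push Not at h
    constructor
    · rintro rfl d
      exact ⟨fun hd => (h d hd).elim, by omega⟩
    · intro H
      rcases v with _ | d
      · rfl
      · exact (h d ((H d).2 rfl)).elim

theorem turingLE_jumpStage (k : ℕ) : TuringLE (jumpStage k) (charFun (zeroJump k)) := by
  cases k with
  | zero => exact .of_primrec (Primrec.const 0)
  | succ k =>
    set g := charFun (zeroJump (k + 1)) with hg
    have hJ : TuringLE (charFun {p : ℕ | JumpWitness (charFun (zeroJump k)) p.unpair.1
        p.unpair.2}) g :=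
      (turingLE_charFun_jumpWitness _).trans (zeroJump_mono (Nat.le_succ k))
    have hz : TuringLE (charFun {p : ℕ | p.unpair.2 = 0}) g :=
      .charFun_of_primrecPred (Primrec.eq.comp Primrec.id.unpair_snd (.const 0))
    have hX : TuringLE (charFun {p : ℕ | p.unpair.1 ∈ zeroJump (k + 1)}) g :=
      (TuringLE.refl g).charFun_preimage (.of_primrec Primrec.id.unpair_fst)
    have hJ' := hJ.charFun_preimage (f := fun p => Nat.pair p.unpair.1 (p.unpair.2 - 1))
      (.of_primrec (.natPair Primrec.id.unpair_fst
        (Primrec.nat_sub.comp Primrec.id.unpair_snd (.const 1))))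
    -- The relation searched contains (e, 0) for e outside the jump and (e, d + 1) for d a witness
    -- for e. The jump decides the first part, and already ∅⁽ᵏ⁾ decides the second.
    refine TuringLE.find_of_charFun ((hz.charFun_inter hX.charFun_compl).charFun_union
      (hz.charFun_compl.charFun_inter hJ')) (fun e => ?_) fun e v hv => ?_
    · simp only [Set.mem_union, Set.mem_inter_iff, Set.mem_compl_iff, Set.mem_ofPred_eq,
        Nat.unpair_pair, ← jumpStage_ne_zero (k := k + 1)]
      by_cases h : jumpStage (k + 1) e = 0
      · simp [h]
      · refine .inr ⟨h, ((jumpStage_succ_eq_iff.1 rfl) _).2 (by omega)⟩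
    · simp only [Set.mem_union, Set.mem_inter_iff, Set.mem_compl_iff, Set.mem_ofPred_eq,
        Nat.unpair_pair, ← jumpStage_ne_zero (k := k + 1)]
      rintro (h | ⟨h, h'⟩)
      · omega
      · have := (((jumpStage_succ_eq_iff (k := k)).1 rfl (v - 1)).1 h').2
        omega

/-- Passing from n to n + 1 adds one column, recursive in ∅⁽ⁿ⁺¹⁾, while the earlier columns are
already recursive in ∅⁽ⁿ⁾. -/
theorem turingLE_jumpPath (n : ℕ) : TuringLE (jumpPath n) (charFun (zeroJump n)) := by
  induction n with
  | zero =>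
    convert TuringLE.of_primrec (Primrec.const 0) using 1
    funext p
    by_cases h : p.unpair.1 = 0 <;> simp [jumpPath, h, jumpStage]
  | succ n ih =>
    have h1 := ih.trans (zeroJump_mono (Nat.le_succ n))
    have h2 := (turingLE_jumpStage (n + 1)).comp
      (.of_primrec (Primrec.id.unpair_snd : Primrec fun p : ℕ => p.unpair.2))
    have hF : Primrec fun q : ℕ × ℕ => if q.1.unpair.1 = n + 1 then q.2.unpair.1
        else q.2.unpair.2 :=
      Primrec.ite (Primrec.eq.comp Primrec.fst.unpair_fst (.const _)) Primrec.snd.unpair_fst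
        Primrec.snd.unpair_snd
    convert TuringLE.computable₂_comp (F := fun p q => if p.unpair.1 = n + 1 then q.unpair.1
      else q.unpair.2) hF.to_comp (.of_primrec Primrec.id) (h2.pair h1) using 1
    funext p
    rcases lt_trichotomy p.unpair.1 (n + 1) with h | h | h
    · simp [jumpPath, h.le, h.ne, Nat.lt_succ_iff.1 h]
    · simp [jumpPath, h]
    · simp [jumpPath, h.ne', not_le.2 h, not_le.2 (Nat.lt_of_succ_lt h)]

/-- The support of column n is ∅⁽ⁿ⁾ by `jumpStage_ne_zero`. -/
theorem zeroJump_turingLE_jumpPath (n : ℕ) : TuringLE (charFun (zeroJump n)) (jumpPath n) := by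
  have h : TuringLE (fun e => jumpPath n (Nat.pair n e)) (jumpPath n) :=
    (TuringLE.refl _).comp (.of_primrec (.natPair (.const n) Primrec.id))
  have hF : Primrec fun v : ℕ => if v = 0 then 0 else 1 :=
    Primrec.ite (Primrec.eq.comp Primrec.id (.const 0)) (.const 0) (.const 1)
  convert (TuringLE.of_primrec hF).comp h using 1
  funext e
  have := jumpStage_ne_zero (k := n) (e := e)
  by_cases h : e ∈ zeroJump n
  · simp [charFun_of_mem h, jumpPath, this.2 h]
  · simp [charFun_of_notMem h, jumpPath, not_ne_iff.1 (mt this.1 h)]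

/-! ## Recursive trees with a single path -/

/-- The characteristic function of the `k`-th column of `x`. -/
def columnSupport (x : ℕ → ℕ) (k a : ℕ) : ℕ := if x (Nat.pair k a) = 0 then 0 else 1

/-- The `m`-th instance of the condition that characterizes `jumpPath n`. -/
def JumpCondition (n : ℕ) (x : ℕ → ℕ) (m : ℕ) : Prop :=
  x (Nat.pair 0 m.unpair.2.unpair.1) = 0 ∧
  (n ≤ m.unpair.1 → x (Nat.pair (m.unpair.1 + 1) m.unpair.2.unpair.1) = 0) ∧
  (m.unpair.1 < n →
    (JumpWitness (columnSupport x m.unpair.1) m.unpair.2.unpair.1 m.unpair.2.unpair.2 →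
      0 < x (Nat.pair (m.unpair.1 + 1) m.unpair.2.unpair.1) ∧
        x (Nat.pair (m.unpair.1 + 1) m.unpair.2.unpair.1) ≤ m.unpair.2.unpair.2 + 1) ∧
    (x (Nat.pair (m.unpair.1 + 1) m.unpair.2.unpair.1) = m.unpair.2.unpair.2 + 1 →
      JumpWitness (columnSupport x m.unpair.1) m.unpair.2.unpair.1 m.unpair.2.unpair.2))

/-- A bound for the arguments at which `JumpCondition n x m` depends on `x`. -/
def jumpUse (m : ℕ) : ℕ :=
  Nat.pair 0 m.unpair.2.unpair.1 + Nat.pair (m.unpair.1 + 1) m.unpair.2.unpair.1 +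
    Nat.pair m.unpair.1 m.unpair.2.unpair.2 + 1

/-- With m = (k, (e, d)), the condition reads x at (0, e), at (k + 1, e), and, through the witness
relation, at (k, a) for a ≤ d. Pairing is increasing in its second argument, so `jumpUse m` exceeds
all these places. -/
theorem JumpCondition.congr {n m : ℕ} {x y : ℕ → ℕ} (h : ∀ i < jumpUse m, x i = y i) :
    JumpCondition n x m ↔ JumpCondition n y m := by
  have hJ : JumpWitness (columnSupport x m.unpair.1) m.unpair.2.unpair.1 m.unpair.2.unpair.2 ↔
      JumpWitness (columnSupport y m.unpair.1) m.unpair.2.unpair.1 m.unpair.2.unpair.2 := by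
    refine jumpWitness_congr fun a ha => ?_
    have h1 : Nat.pair m.unpair.1 a ≤ Nat.pair m.unpair.1 m.unpair.2.unpair.2 := by
      rcases ha.lt_or_eq with ha | rfl
      exacts [(Nat.pair_lt_pair_right _ ha).le, le_rfl]
    rw [columnSupport, columnSupport, h _ (by unfold jumpUse; omega)]
  rw [JumpCondition, JumpCondition, h (Nat.pair 0 m.unpair.2.unpair.1) (by unfold jumpUse; omega),
    h (Nat.pair (m.unpair.1 + 1) m.unpair.2.unpair.1) (by unfold jumpUse; omega), hJ]

/-- The columns are pinned down one after the other. Once column k is correct, its support is ∅⁽ᵏ⁾,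
so the conditions on column k + 1 refer to the right oracle and `jumpStage_succ_eq_iff` determines
that column. -/
theorem forall_jumpCondition_iff {n : ℕ} {x : ℕ → ℕ} :
    (∀ m, JumpCondition n x m) ↔ x = jumpPath n := by
  have hcol : ∀ {k}, (∀ e, x (Nat.pair k e) = jumpStage k e) →
      columnSupport x k = charFun (zeroJump k) := by
    intro k hk
    funext e
    by_cases h : e ∈ zeroJump k
    · simp [columnSupport, hk, jumpStage_ne_zero.2 h, charFun_of_mem h]
    · simp [columnSupport, hk, not_ne_iff.1 (mt jumpStage_ne_zero.1 h), charFun_of_notMem h]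
  constructor
  · intro H
    have H' : ∀ k e d, _ := fun k e d => H (Nat.pair k (Nat.pair e d))
    simp only [JumpCondition, Nat.unpair_pair] at H'
    have h1 : ∀ k ≤ n, ∀ e, x (Nat.pair k e) = jumpStage k e := by
      intro k
      induction k with
      | zero => exact fun _ e => (H' 0 e 0).1
      | succ k ih =>
        intro hk e
        symm
        rw [jumpStage_succ_eq_iff, ← hcol (ih (by omega))]
        exact fun d => (H' k e d).2.2 hk
    funext p
    obtain ⟨k, e, rfl⟩ : ∃ k e, p = Nat.pair k e := ⟨_, _, (Nat.pair_unpair p).symm⟩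
    by_cases hk : k ≤ n
    · simp [jumpPath, hk, h1 k hk e]
    · obtain ⟨k, rfl⟩ := Nat.exists_eq_succ_of_ne_zero (by omega : k ≠ 0)
      simpa [jumpPath, hk] using (H' k e 0).2.1 (by omega)
  · rintro rfl m
    refine ⟨by simp [jumpPath, jumpStage], fun h => ?_, fun h => ?_⟩
    · simp [jumpPath, not_le.2 (Nat.lt_succ_of_le h)]
    · rw [hcol fun e => by simp [jumpPath, h.le]]
      have : jumpPath n (Nat.pair (m.unpair.1 + 1) m.unpair.2.unpair.1) =
        jumpStage (m.unpair.1 + 1) m.unpair.2.unpair.1 := by simp [jumpPath, Nat.succ_le_of_lt h]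
      exact jumpStage_succ_eq_iff.1 this.symm _

/-- A recursive tree whose only path is `jumpPath n`. -/
def jumpTree (n : ℕ) : Set (List ℕ) :=
  {σ | ∀ m < σ.length, jumpUse m ≤ σ.length → JumpCondition n (fun i => σ.getD i 0) m}

/-- A condition whose use fits into the shorter sequence reads the same entries in the longer one,
where it is also tested. -/
theorem isTree_jumpTree (n : ℕ) : IsTree (jumpTree n) := by
  rintro σ hσ τ ⟨ρ, rfl⟩ m hm hu
  have := hσ m (by simp; omega) (by simp; omega)
  rwa [JumpCondition.congr fun i hi => List.getD_append τ ρ 0 i (by omega)] at this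

theorem treePaths_jumpTree (n : ℕ) : treePaths (jumpTree n) = {jumpPath n} := by
  ext x
  rw [Set.mem_singleton_iff, ← forall_jumpCondition_iff]
  constructor
  · intro hx m
    -- This initial segment is long enough for condition m to be among those tested.
    have := hx (m + 1 + jumpUse m) m (by simp; omega) (by simp)
    rwa [JumpCondition.congr fun i hi => getD_map_range x (by omega)] at this
  · intro H N m _ hu
    rw [List.length_map, List.length_range] at hu
    rw [JumpCondition.congr fun i hi => getD_map_range x (by omega)]
    exact H m

theorem primrecPred_jumpTree : PrimrecPred fun p : ℕ × List ℕ => p.2 ∈ jumpTree p.1 := by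
  have m : Primrec fun y : ℕ × ℕ × List ℕ => y.1 := Primrec.fst
  have n : Primrec fun y : ℕ × ℕ × List ℕ => y.2.1 := Primrec.fst.comp Primrec.snd
  have s : Primrec fun y : ℕ × ℕ × List ℕ => y.2.2 := Primrec.snd.comp Primrec.snd
  have k := m.unpair_fst
  have e := m.unpair_snd.unpair_fst
  have d := m.unpair_snd.unpair_snd
  have c := fun i : ℕ => (Primrec.const i : Primrec fun _ : ℕ × ℕ × List ℕ => i)
  have k1 : Primrec fun y : ℕ × ℕ × List ℕ => y.1.unpair.1 + 1 := Primrec.succ.comp k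
  have d1 : Primrec fun y : ℕ × ℕ × List ℕ => y.1.unpair.2.unpair.2 + 1 := Primrec.succ.comp d
  have v := (Primrec.list_getD 0).comp s (.natPair k1 e)
  have imp : ∀ {p q : ℕ × ℕ × List ℕ → Prop}, PrimrecPred p → PrimrecPred q →
      PrimrecPred fun y => p y → q y :=
    fun hp hq => (hp.not.or hq).of_eq fun _ => imp_iff_not_or.symm
  have hJ : PrimrecPred fun y : ℕ × ℕ × List ℕ =>
      JumpWitness (columnSupport (fun i => y.2.2.getD i 0) y.1.unpair.1) y.1.unpair.2.unpair.1
        y.1.unpair.2.unpair.2 := by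
    -- The oracle is replaced by the list of its values up to the witness d, which is all that the
    -- witness relation depends on.
    have hO : Primrec fun y : ℕ × ℕ × List ℕ => (List.range (y.1.unpair.2.unpair.2 + 1)).map
        (columnSupport (fun i => y.2.2.getD i 0) y.1.unpair.1) := by
      refine Primrec.list_map (Primrec.list_range.comp d1) ?_
      show Primrec fun z : (ℕ × ℕ × List ℕ) × ℕ =>
        if z.1.2.2.getD (Nat.pair z.1.1.unpair.1 z.2) 0 = 0 then 0 else 1
      exact Primrec.ite (Primrec.eq.comp ((Primrec.list_getD 0).comp (s.comp Primrec.fst)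
        (.natPair (k.comp Primrec.fst) Primrec.snd)) (.const 0)) (.const 0) (.const 1)
    exact (primrecPred_jumpWitness hO e d).of_eq fun y =>
      jumpWitness_congr fun a ha => getD_map_range _ (Nat.lt_succ_of_le ha)
  refine .of_forall_lt (Primrec.list_length.comp Primrec.snd)
    (imp (Primrec.nat_le.comp ?_ (Primrec.list_length.comp s)) (.and ?_ (.and ?_ ?_)))
  · exact Primrec.succ.comp (Primrec.nat_add.comp (Primrec.nat_add.comp (.natPair (c 0) e)
      (.natPair k1 e)) (.natPair k d))
  · exact Primrec.eq.comp ((Primrec.list_getD 0).comp s (.natPair (c 0) e)) (c 0)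
  · exact imp (Primrec.nat_le.comp n k) (Primrec.eq.comp v (c 0))
  · exact imp (Primrec.nat_lt.comp k n) (.and
      (imp hJ (.and (Primrec.nat_lt.comp (c 0) v) (Primrec.nat_le.comp v d1)))
      (imp (Primrec.eq.comp v d1) hJ))

/-! ## The union tree -/

theorem cons_mem_unionTree {T : ℕ → Set (List ℕ)} {n : ℕ} {σ : List ℕ} :
    n :: σ ∈ unionTree T ↔ σ ∈ T n := by
  constructor
  · rintro (h | ⟨m, τ, hτ, h⟩)
    · simp at h
    · obtain ⟨rfl, rfl⟩ := List.cons_eq_cons.1 h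
      exact hτ
  · exact fun h => .inr ⟨n, σ, h, rfl⟩

theorem isTree_unionTree {T : ℕ → Set (List ℕ)} (hT : ∀ n, IsTree (T n)) :
    IsTree (unionTree T) := by
  rintro σ hσ τ hτ
  cases τ with
  | nil => exact .inl rfl
  | cons n τ =>
    obtain ⟨ρ, rfl⟩ := hτ
    exact cons_mem_unionTree.2 (hT n _ (cons_mem_unionTree.1 hσ) τ ⟨ρ, rfl⟩)

theorem mem_treePaths_unionTree {T : ℕ → Set (List ℕ)} {y : ℕ → ℕ} :
    y ∈ treePaths (unionTree T) ↔ (fun i => y (i + 1)) ∈ treePaths (T (y 0)) := by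
  have key : ∀ n, (List.range (n + 1)).map y ∈ unionTree T ↔
      (List.range n).map (fun i => y (i + 1)) ∈ T (y 0) := by
    intro n
    rw [List.range_succ_eq_map, List.map_cons, cons_mem_unionTree, List.map_map]
    rfl
  refine ⟨fun h n => (key n).1 (h (n + 1)), fun h n => ?_⟩
  cases n with
  | zero => exact .inl rfl
  | succ n => exact (key n).2 (h n)

/-- The real `n⌢y`. -/
def consReal (n : ℕ) (y : ℕ → ℕ) : ℕ → ℕ
  | 0 => n
  | i + 1 => y i

theorem turingLE_consReal (n : ℕ) (y : ℕ → ℕ) : TuringLE y (consReal n y) :=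
  (TuringLE.refl (consReal n y)).comp (.of_primrec Primrec.succ)

theorem consReal_turingLE (n : ℕ) (y : ℕ → ℕ) : TuringLE (consReal n y) y := by
  have hF : Primrec fun q : ℕ × ℕ => if q.1 = 0 then n else q.2 :=
    Primrec.ite (Primrec.eq.comp Primrec.fst (.const 0)) (.const n) Primrec.snd
  convert TuringLE.computable₂_comp (F := fun i v => if i = 0 then n else v) hF.to_comp
    (.of_primrec Primrec.id) ((TuringLE.refl y).comp (.of_primrec Primrec.pred)) using 1
  funext i
  cases i <;> simp [consReal]

theorem treePaths_unionTree_eq_range {T : ℕ → Set (List ℕ)} {x : ℕ → ℕ → ℕ}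
    (hT : ∀ n, treePaths (T n) = {x n}) :
    treePaths (unionTree T) = Set.range fun n => consReal n (x n) := by
  ext y
  rw [mem_treePaths_unionTree, hT, Set.mem_singleton_iff]
  constructor
  · intro h
    refine ⟨y 0, ?_⟩
    dsimp only
    rw [← h]
    funext i
    cases i <;> rfl
  · rintro ⟨n, rfl⟩
    rfl

theorem primrecPred_unionTree {T : ℕ → Set (List ℕ)}
    (hT : PrimrecPred fun p : ℕ × List ℕ => p.2 ∈ T p.1) :
    PrimrecPred fun σ : List ℕ => σ ∈ unionTree T := by
  have h : PrimrecPred fun σ : List ℕ => σ = [] ∨ σ.tail ∈ T σ.headI :=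
    (Primrec.eq.comp Primrec.id (.const [])).or
      (hT.comp (Primrec.pair Primrec.list_headI Primrec.list_tail))
  refine h.of_eq fun σ => ?_
  cases σ with
  | nil => simp [unionTree]
  | cons n σ => simp [cons_mem_unionTree]

/-! ## Perfect trees -/

theorem IsPerfectTree.exists_extension {S : Set (List ℕ)} (hS : IsPerfectTree S) {σ : List ℕ}
    (hσ : σ ∈ S) : ∃ τ ∈ S, σ <+: τ ∧ σ.length < τ.length := by
  obtain ⟨τ, hτ, υ, -, h1, h2, h3, -⟩ := hS.2.2 σ hσ
  refine ⟨τ, hτ, h1, lt_of_le_of_ne h1.length_le fun h => h3 ?_⟩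
  rwa [← h1.eq_of_length h]

/-- Splitting gives every node a proper extension; iterating from σ yields a chain of nodes whose
union is the path. -/
theorem IsPerfectTree.exists_path {S : Set (List ℕ)} (hS : IsPerfectTree S) {σ : List ℕ}
    (hσ : σ ∈ S) : ∃ x ∈ treePaths S, (List.range σ.length).map x = σ := by
  choose! next hnext hpre hlen using fun τ (hτ : τ ∈ S) => hS.exists_extension hτ
  have hmem : ∀ k, next^[k] σ ∈ S := by
    intro k
    induction k with
    | zero => exact hσ
    | succ k ih => rw [Function.iterate_succ_apply']; exact hnext _ ih
  have hmono : ∀ i j, i ≤ j → next^[i] σ <+: next^[j] σ := by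
    intro i j hij
    induction hij with
    | refl => exact List.prefix_rfl
    | step _ ih => rw [Function.iterate_succ_apply']; exact ih.trans (hpre _ (hmem _))
  have hlength : ∀ k, k ≤ (next^[k] σ).length := by
    intro k
    induction k with
    | zero => exact Nat.zero_le _
    | succ k ih =>
      rw [Function.iterate_succ_apply']
      exact Nat.succ_le_of_lt (ih.trans_lt (hlen _ (hmem k)))
  -- Entry k of the path is read off at stage k + 1, the first at which the length is guaranteed to
  -- exceed k; any other stage long enough agrees with it.
  have hval : ∀ j k, k < (next^[j] σ).length →
      (next^[k + 1] σ).getD k 0 = (next^[j] σ).getD k 0 := by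
    have haux : ∀ i j k, i ≤ j → k < (next^[i] σ).length →
        (next^[j] σ).getD k 0 = (next^[i] σ).getD k 0 := by
      intro i j k hij hk
      obtain ⟨ρ, hρ⟩ := hmono i j hij
      rw [← hρ, List.getD_append _ _ _ _ hk]
    intro j k hk
    rcases le_total (k + 1) j with h | h
    · exact (haux _ _ k h (hlength (k + 1))).symm
    · exact haux _ _ k h hk
  have hseg : ∀ n j, n ≤ (next^[j] σ).length →
      (List.range n).map (fun k => (next^[k + 1] σ).getD k 0) = (next^[j] σ).take n := by
    intro n j hn
    refine List.ext_getElem (by simp [hn]) fun k hk _ => ?_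
    simp only [List.length_map, List.length_range] at hk
    simp only [List.getElem_map, List.getElem_range, List.getElem_take]
    rw [hval j k (by omega), List.getD_eq_getElem]
  refine ⟨fun k => (next^[k + 1] σ).getD k 0, fun n => ?_, ?_⟩
  · rw [hseg n n (hlength n)]
    exact hS.1 _ (hmem n) _ (List.take_prefix _ _)
  · rw [hseg σ.length 0 le_rfl]
    simp

/-- Two incomparable nodes above a common nonempty node extend to paths with the same first entry.
Since each subtree has at most one path, these paths coincide, and initial segments of one path are
comparable. -/
theorem not_isPerfectTree_of_subset_unionTree {T : ℕ → Set (List ℕ)}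
    (hT : ∀ n, (treePaths (T n)).Subsingleton) {S : Set (List ℕ)} (hS : S ⊆ unionTree T) :
    ¬ IsPerfectTree S := by
  intro hp
  obtain ⟨σ, hσ⟩ := hp.2.1
  -- One proper extension leaves the root, where the union tree could branch.
  obtain ⟨τ, hτ, -, hlen⟩ := hp.exists_extension hσ
  obtain ⟨υ₁, h₁, υ₂, h₂, p₁, p₂, n₁, n₂⟩ := hp.2.2 τ hτ
  obtain ⟨x₁, hx₁, e₁⟩ := hp.exists_path h₁
  obtain ⟨x₂, hx₂, e₂⟩ := hp.exists_path h₂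
  have hzero : ∀ {x : ℕ → ℕ} {υ : List ℕ}, τ <+: υ → (List.range υ.length).map x = υ →
      x 0 = τ.getD 0 0 := by
    rintro x υ ⟨ρ, rfl⟩ he
    rw [← getD_map_range x (n := (τ ++ ρ).length) (by simp; omega), he,
      List.getD_append _ _ _ _ (by omega)]
  have hsub : treePaths S ⊆ treePaths (unionTree T) := fun x hx n => hS (hx n)
  have m₁ := mem_treePaths_unionTree.1 (hsub hx₁)
  have m₂ := mem_treePaths_unionTree.1 (hsub hx₂)
  rw [hzero p₁ e₁] at m₁
  rw [hzero p₂ e₂] at m₂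
  have hx : x₁ = x₂ := by
    funext i
    cases i with
    | zero => rw [hzero p₁ e₁, hzero p₂ e₂]
    | succ i => exact congrFun (hT _ m₁ m₂) i
  subst hx
  have hpre : ∀ {m n : ℕ}, m ≤ n → (List.range m).map x₁ <+: (List.range n).map x₁ := by
    intro m n h
    obtain ⟨k, rfl⟩ := Nat.exists_eq_add_of_le h
    rw [List.range_add, List.map_append]
    exact List.prefix_append _ _
  rcases le_total υ₁.length υ₂.length with h | h
  · exact n₁ (e₁ ▸ e₂ ▸ hpre h)
  · exact n₂ (e₁ ▸ e₂ ▸ hpre h)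

/-! ## Closure properties of the arithmetical sets -/

theorem mem_arithmeticalSets_of_turingLE {A : Set ℕ} {g : ℕ → ℕ} (h : TuringLE (charFun A) g)
    (hg : IsArithmeticalReal g) : A ∈ arithmeticalSets :=
  hg.imp fun _ hn => h.trans hn

theorem mem_arithmeticalSets_of_primrecPred {p : ℕ → Prop} (hp : PrimrecPred p) :
    {n | p n} ∈ arithmeticalSets :=
  ⟨0, .charFun_of_primrecPred hp⟩

theorem compl_mem_arithmeticalSets {A : Set ℕ} (hA : A ∈ arithmeticalSets) :
    Aᶜ ∈ arithmeticalSets :=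
  hA.imp fun _ h => h.charFun_compl

theorem inter_mem_arithmeticalSets {A B : Set ℕ} (hA : A ∈ arithmeticalSets)
    (hB : B ∈ arithmeticalSets) : A ∩ B ∈ arithmeticalSets := by
  obtain ⟨m, hm⟩ := hA
  obtain ⟨n, hn⟩ := hB
  exact ⟨max m n, (hm.trans (zeroJump_mono (le_max_left _ _))).charFun_inter
    (hn.trans (zeroJump_mono (le_max_right _ _)))⟩

theorem preimage_mem_arithmeticalSets {A : Set ℕ} (hA : A ∈ arithmeticalSets) {f : ℕ → ℕ}
    (hf : Primrec f) : {n | f n ∈ A} ∈ arithmeticalSets :=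
  hA.imp fun _ h => h.charFun_preimage (.of_primrec hf)

theorem exists_mem_arithmeticalSets {R : Set ℕ} (hR : R ∈ arithmeticalSets) :
    {n | ∃ m, Nat.pair n m ∈ R} ∈ arithmeticalSets := by
  obtain ⟨k, hk⟩ := hR
  exact ⟨k + 1, zeroJump_succ k ▸ turingLE_turingJump_of_projection hk⟩

theorem forall_mem_arithmeticalSets {R : Set ℕ} (hR : R ∈ arithmeticalSets) :
    {n | ∀ m, Nat.pair n m ∈ R} ∈ arithmeticalSets := by
  have := compl_mem_arithmeticalSets (exists_mem_arithmeticalSets (compl_mem_arithmeticalSets hR))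
  convert this using 1
  ext n
  simp

/-! ## Satisfaction in the model of arithmetical sets -/

/-- The value of a term in the standard model. -/
def L2Term.val (v : ℕ → ℕ) : L2Term → ℕ
  | var i => v i
  | zero => 0
  | one => 1
  | add s t => s.val v + t.val v
  | mul s t => s.val v * t.val v

/-- Satisfaction in `arithmeticalModel`, with sets of natural numbers as values of the set
variables. -/
def Sat : L2Formula → (ℕ → ℕ) → (ℕ → Set ℕ) → Prop
  | .eq s t, v, _ => s.val v = t.val v
  | .lt s t, v, _ => s.val v < t.val v
  | .mem t i, v, V => t.val v ∈ V i
  | .neg φ, v, V => ¬ Sat φ v V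
  | .and φ ψ, v, V => Sat φ v V ∧ Sat ψ v V
  | .allNum i φ, v, V => ∀ n, Sat φ (Function.update v i n) V
  | .allSet i φ, v, V => ∀ X ∈ arithmeticalSets, Sat φ v (Function.update V i X)

theorem termValue_arithmeticalModel (v : ℕ → ℕ) (t : L2Term) :
    arithmeticalModel.termValue v t = t.val v := by
  induction t with
  | var | zero | one => rfl
  | add s t ihs iht => exact congrArg₂ (· + ·) ihs iht
  | mul s t ihs iht => exact congrArg₂ (· * ·) ihs iht

theorem realize_iff_sat (φ : L2Formula) : ∀ (v : ℕ → ℕ) (V : ℕ → arithmeticalSets),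
    arithmeticalModel.Realize φ v V ↔ Sat φ v fun i => (V i : Set ℕ) := by
  induction φ with
  | eq s t =>
    intro v V
    rw [Sat, ← termValue_arithmeticalModel, ← termValue_arithmeticalModel]; rfl
  | lt s t =>
    intro v V
    rw [Sat, ← termValue_arithmeticalModel, ← termValue_arithmeticalModel]; rfl
  | mem t i =>
    intro v V
    rw [Sat, ← termValue_arithmeticalModel]; rfl
  | neg φ ih => exact fun v V => not_congr (ih v V)
  | and φ ψ ihφ ihψ => exact fun v V => and_congr (ihφ v V) (ihψ v V)
  | allNum i φ ih => exact fun v V => forall_congr' fun n => ih _ V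
  | allSet i φ ih =>
    intro v V
    have key : ∀ X : arithmeticalSets,
        arithmeticalModel.Realize φ v (Function.update (β := fun _ => arithmeticalSets) V i X) ↔
          Sat φ v (Function.update (fun k => (V k : Set ℕ)) i X) := by
      intro X
      rw [ih]
      refine iff_of_eq (congrArg _ (funext fun k => ?_))
      by_cases h : k = i
      · subst h; simp
      · simp [h]
    exact ⟨fun H X hX => (key ⟨X, hX⟩).1 (H ⟨X, hX⟩), fun H X => (key X).2 (H X.1 X.2)⟩

theorem arithmeticalModel_models_iff {φ : L2Formula} : arithmeticalModel.Models φ ↔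
    ∀ (v : ℕ → ℕ) (V : ℕ → Set ℕ), (∀ i, V i ∈ arithmeticalSets) → Sat φ v V :=
  ⟨fun H v V hV => (realize_iff_sat φ v fun i => ⟨V i, hV i⟩).1 (H v _),
    fun H v V => (realize_iff_sat φ v V).2 (H v _ fun i => (V i).2)⟩

section

variable {v : ℕ → ℕ} {V : ℕ → Set ℕ} {φ ψ : L2Formula} {i : ℕ}

theorem sat_or : Sat (.or φ ψ) v V ↔ Sat φ v V ∨ Sat ψ v V := by
  simp only [L2Formula.or, Sat]; tauto

theorem sat_imp : Sat (.imp φ ψ) v V ↔ (Sat φ v V → Sat ψ v V) := by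
  simp only [L2Formula.imp, Sat]; tauto

theorem sat_iff : Sat (.iff φ ψ) v V ↔ (Sat φ v V ↔ Sat ψ v V) := by
  simp only [L2Formula.iff, Sat, sat_imp]; tauto

theorem sat_exNum : Sat (.exNum i φ) v V ↔ ∃ n, Sat φ (Function.update v i n) V := by
  simp [L2Formula.exNum, Sat]

theorem sat_exSet :
    Sat (.exSet i φ) v V ↔ ∃ X ∈ arithmeticalSets, Sat φ v (Function.update V i X) := by
  simp [L2Formula.exSet, Sat]

end

/-! ## The arithmetical sets form a model of `ACA₀` -/

theorem primrec_val {w : ℕ → ℕ → ℕ} (hw : ∀ i, Primrec (w i)) (t : L2Term) :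
    Primrec fun s => t.val fun i => w i s := by
  induction t with
  | var i => exact hw i
  | zero => exact .const 0
  | one => exact .const 1
  | add _ _ ihs iht => exact Primrec.nat_add.comp ihs iht
  | mul _ _ ihs iht => exact Primrec.nat_mul.comp ihs iht

/-- Sets that are arithmetically definable from arithmetical sets are arithmetical. -/
theorem definable_mem_arithmeticalSets {V : ℕ → Set ℕ} (hV : ∀ i, V i ∈ arithmeticalSets)
    {φ : L2Formula} (hφ : φ.IsArithmetical) :
    ∀ {w : ℕ → ℕ → ℕ}, (∀ i, Primrec (w i)) →
      {s | Sat φ (fun i => w i s) V} ∈ arithmeticalSets := by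
  induction φ with
  | eq s t =>
    exact fun hw => mem_arithmeticalSets_of_primrecPred
      (Primrec.eq.comp (primrec_val hw s) (primrec_val hw t))
  | lt s t =>
    exact fun hw => mem_arithmeticalSets_of_primrecPred
      (Primrec.nat_lt.comp (primrec_val hw s) (primrec_val hw t))
  | mem t i => exact fun hw => preimage_mem_arithmeticalSets (hV i) (primrec_val hw t)
  | neg φ ih => exact fun hw => compl_mem_arithmeticalSets (ih hφ hw)
  | and φ ψ ihφ ihψ => exact fun hw => inter_mem_arithmeticalSets (ihφ hφ.1 hw) (ihψ hφ.2 hw)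
  | allNum j φ ih =>
    intro w hw
    -- The assignment is a family of primitive recursive functions of one parameter. Under the
    -- quantifier the parameter becomes a pair: its second component is the value of the bound
    -- variable, and its first is the old parameter.
    have := forall_mem_arithmeticalSets (ih hφ (w := fun i p =>
      if i = j then p.unpair.2 else w i p.unpair.1) fun i => by
        by_cases h : i = j
        · simpa [h] using (Primrec.id.unpair_snd : Primrec fun p : ℕ => p.unpair.2)
        · simpa [h] using (hw i).comp (Primrec.id.unpair_fst : Primrec fun p : ℕ => p.unpair.1))
    convert this using 1
    ext s
    refine forall_congr' fun n => iff_of_eq (congrArg (Sat φ · V) (funext fun i => ?_))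
    simp [Function.update_apply]
  | allSet i φ => exact hφ.elim

theorem sat_update_of_not_setVarFree {i : ℕ} {X : Set ℕ} {V : ℕ → Set ℕ} {φ : L2Formula}
    (hφ : φ.IsArithmetical) (hi : ¬ φ.SetVarFree i) :
    ∀ {v : ℕ → ℕ}, Sat φ v (Function.update V i X) ↔ Sat φ v V := by
  induction φ with
  | eq | lt => exact Iff.rfl
  | mem t j =>
    have : j ≠ i := fun h => hi h.symm
    simp [Sat, this]
  | neg φ ih => exact not_congr (ih hφ hi)
  | and φ ψ ihφ ihψ =>
    exact and_congr (ihφ hφ.1 fun h => hi (.inl h)) (ihψ hφ.2 fun h => hi (.inr h))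
  | allNum j φ ih => exact forall_congr' fun n => ih hφ hi
  | allSet => exact hφ.elim

theorem sat_comprehension {i j : ℕ} {φ : L2Formula} (hφ : φ.IsArithmetical)
    (hi : ¬ φ.SetVarFree i) (v : ℕ → ℕ) {V : ℕ → Set ℕ} (hV : ∀ k, V k ∈ arithmeticalSets) :
    Sat (ACA.comprehension i j φ) v V := by
  refine sat_exSet.2 ⟨{n | Sat φ (Function.update v j n) V}, ?_, fun n => ?_⟩
  · have := definable_mem_arithmeticalSets hV hφ (w := fun k n => if k = j then n else v k)
      fun k => by
        by_cases h : k = j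
        · simp only [h, if_true]; exact Primrec.id
        · simpa [h] using Primrec.const (v k)
    convert this using 1
    ext n
    exact iff_of_eq (congrArg (Sat φ · V) (funext fun k => Function.update_apply ..))
  · rw [sat_iff, sat_update_of_not_setVarFree hφ hi]
    simp [Sat, L2Term.val]

theorem arithmeticalModel_modelsTheory_ACA0 : arithmeticalModel.ModelsTheory ACA0 := by
  intro φ hφ
  refine arithmeticalModel_models_iff.2 fun v V hV => ?_
  rcases hφ with (hφ | rfl) | ⟨i, j, ψ, hψ, hi, rfl⟩
  · simp only [ACA.basicAxioms, Set.mem_insert_iff, Set.mem_singleton_iff] at hφ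
    rcases hφ with rfl | rfl | rfl | rfl | rfl | rfl | rfl | rfl <;>
      simp only [sat_imp, sat_iff, sat_or, Sat, L2Term.val] <;>
      first | omega | ring
  · rw [ACA.inductionAxiom, sat_imp]
    simp only [Sat, sat_imp, L2Term.val, Function.update_self]
    exact fun h n => Nat.rec h.1 h.2 n
  · exact sat_comprehension hψ hi v hV

/-! ## Semantics of schemes -/

attribute [simp] L2Term.val

/-- All variables of the term are among the first `k` ones. -/
def L2Term.Below (k : ℕ) : L2Term → Prop
  | var i => i < k
  | zero => True
  | one => True
  | add s t => s.Below k ∧ t.Below k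
  | mul s t => s.Below k ∧ t.Below k

@[simp] theorem L2Term.below_var {k i : ℕ} : (var i).Below k ↔ i < k := Iff.rfl
@[simp] theorem L2Term.below_zero {k : ℕ} : zero.Below k ↔ True := Iff.rfl
@[simp] theorem L2Term.below_one {k : ℕ} : one.Below k ↔ True := Iff.rfl
@[simp] theorem L2Term.below_add {k : ℕ} {s t : L2Term} :
    (add s t).Below k ↔ s.Below k ∧ t.Below k := Iff.rfl

theorem L2Term.Below.add_right {k : ℕ} {t : L2Term} (h : t.Below k) (n : ℕ) : t.Below (k + n) := by
  induction t with
  | var i => exact Nat.lt_add_right n h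
  | zero | one => trivial
  | add _ _ ihs iht | mul _ _ ihs iht => exact ⟨ihs h.1, iht h.2⟩

-- Quantifiers of schemes bind the first unused variable, so terms built earlier keep their values.
-- This is what excludes variable capture in the evaluations below.
@[simp] theorem L2Term.val_update {k n : ℕ} {t : L2Term} {v : ℕ → ℕ} (h : t.Below k) :
    t.val (Function.update v k n) = t.val v := by
  induction t with
  | var i => exact Function.update_of_ne (Nat.ne_of_lt h) _ _
  | zero | one => rfl
  | add _ _ ihs iht => exact congrArg₂ (· + ·) (ihs h.1) (iht h.2)
  | mul _ _ ihs iht => exact congrArg₂ (· * ·) (ihs h.1) (iht h.2)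

theorem getElem?_seqOf_eq_some {s i x : ℕ} : (seqOf s)[i]? = some x ↔
    i < s.unpair.1 ∧ Nat.beta s.unpair.2 i = x := by
  by_cases h : i < s.unpair.1 <;> simp [seqOf, h]

/-- `s` is the least code of a sequence. -/
def IsCode (s : ℕ) : Prop := ∀ t < s, seqOf t ≠ seqOf s

theorem ext_seqOf {s t : ℕ} : (∀ i x : ℕ, (seqOf s)[i]? = some x ↔ (seqOf t)[i]? = some x) ↔
    seqOf s = seqOf t :=
  ⟨fun h => List.ext_getElem? fun i => Option.ext fun x => h i x, fun h => by simp [h]⟩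

theorem prefix_iff_getElem? {σ τ : List ℕ} :
    σ <+: τ ↔ ∀ i x : ℕ, σ[i]? = some x → τ[i]? = some x := by
  rw [List.prefix_iff_getElem?]
  refine ⟨fun h i x hx => ?_, fun h i hi => h i _ (List.getElem?_eq_getElem hi)⟩
  obtain ⟨hi, rfl⟩ := List.getElem?_eq_some_iff.1 hx
  exact h i hi

theorem exists_eq_pair {e n : ℕ} {Q : ℕ → Prop} :
    (∃ x, e = Nat.pair n x ∧ Q x) ↔ e.unpair.1 = n ∧ Q e.unpair.2 := by
  constructor
  · rintro ⟨x, rfl, h⟩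
    simpa using h
  · rintro ⟨rfl, h⟩
    exact ⟨_, (Nat.pair_unpair e).symm, h⟩

theorem exists_eq_pair_pair {e n : ℕ} {Q : ℕ → ℕ → Prop} :
    (∃ x y, e = Nat.pair n (Nat.pair x y) ∧ Q x y) ↔
      e.unpair.1 = n ∧ Q e.unpair.2.unpair.1 e.unpair.2.unpair.2 := by
  constructor
  · rintro ⟨x, y, rfl, h⟩
    simpa using h
  · rintro ⟨rfl, h⟩
    exact ⟨_, _, by simp, h⟩

/-- The left side is bounded by a list, as primitive recursiveness demands; the right side has the
shape of the formula `justified`. -/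
theorem exists_claim_mem {P : List ℕ} {e a : ℕ} {Q : ℕ → Prop} :
    (∃ p ∈ P, (p.unpair.1 = e ∧ p.unpair.2.unpair.1 = a) ∧ Q p.unpair.2.unpair.2) ↔
      ∃ u, claim e a u ∈ P ∧ Q u := by
  constructor
  · rintro ⟨p, hp, ⟨rfl, rfl⟩, h⟩
    exact ⟨_, by simpa [claim] using hp, h⟩
  · rintro ⟨u, hu, h⟩
    exact ⟨_, hu, by simp [claim], by simpa [claim] using h⟩

namespace Scheme

variable {k l : ℕ} {v : ℕ → ℕ} {V : ℕ → Set ℕ} {A B : Scheme} {s t : L2Term}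

@[simp] theorem sat_eq : Sat (Scheme.eq s t k l) v V ↔ s.val v = t.val v := Iff.rfl
@[simp] theorem sat_lt : Sat (Scheme.lt s t k l) v V ↔ s.val v < t.val v := Iff.rfl
@[simp] theorem sat_mem {X : ℕ} : Sat (Scheme.mem t X k l) v V ↔ t.val v ∈ V X := Iff.rfl
@[simp] theorem sat_neg : Sat (Scheme.neg A k l) v V ↔ ¬ Sat (A k l) v V := Iff.rfl
@[simp] theorem sat_and : Sat (Scheme.and A B k l) v V ↔ Sat (A k l) v V ∧ Sat (B k l) v V := Iff.rfl
@[simp] theorem sat_or : Sat (Scheme.or A B k l) v V ↔ Sat (A k l) v V ∨ Sat (B k l) v V :=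
  _root_.sat_or

@[simp] theorem sat_imp : Sat (Scheme.imp A B k l) v V ↔ (Sat (A k l) v V → Sat (B k l) v V) :=
  _root_.sat_imp

@[simp] theorem sat_iff : Sat (Scheme.iff A B k l) v V ↔ (Sat (A k l) v V ↔ Sat (B k l) v V) :=
  _root_.sat_iff

@[simp] theorem sat_all {A : L2Term → Scheme} : Sat (Scheme.all A k l) v V ↔
    ∀ n, Sat (A (.var k) (k + 1) l) (Function.update v k n) V := Iff.rfl

@[simp] theorem sat_ex {A : L2Term → Scheme} : Sat (Scheme.ex A k l) v V ↔
    ∃ n, Sat (A (.var k) (k + 1) l) (Function.update v k n) V := sat_exNum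

@[simp] theorem sat_allSet {A : ℕ → Scheme} : Sat (Scheme.allSet A k l) v V ↔
    ∀ X ∈ arithmeticalSets, Sat (A l k (l + 1)) v (Function.update V l X) := Iff.rfl

@[simp] theorem sat_exSet {A : ℕ → Scheme} : Sat (Scheme.exSet A k l) v V ↔
    ∃ X ∈ arithmeticalSets, Sat (A l k (l + 1)) v (Function.update V l X) := _root_.sat_exSet

@[simp] theorem val_numeral (n : ℕ) : (numeral n).val v = n := by
  induction n with
  | zero => rfl
  | succ n ih => exact congrArg (· + 1) ih

@[simp] theorem below_numeral (n : ℕ) : (numeral n).Below k := by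
  induction n with
  | zero => trivial
  | succ n ih => exact ⟨ih, trivial⟩

@[simp] theorem sat_isPair {p a b : L2Term} :
    Sat (isPair p a b k l) v V ↔ p.val v = Nat.pair (a.val v) (b.val v) := by
  simp only [isPair, sat_or, sat_and, sat_eq, sat_lt, sat_neg, L2Term.val, Nat.pair]
  split <;> simp [*]

@[simp] theorem sat_pairMem {a b : L2Term} {X : ℕ} (ha : a.Below k) (hb : b.Below k) :
    Sat (pairMem a b X k l) v V ↔ Nat.pair (a.val v) (b.val v) ∈ V X := by
  simp [pairMem, ha, hb]

@[simp] theorem sat_hasLength {s m : L2Term} (hs : s.Below k) (hm : m.Below k) :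
    Sat (hasLength s m k l) v V ↔ (seqOf (s.val v)).length = m.val v := by
  simp only [hasLength, sat_ex, sat_isPair, L2Term.val_update, L2Term.val, hs, hm, length_seqOf,
    Function.update_self]
  constructor
  · rintro ⟨c, h⟩
    simp [h]
  · intro h
    exact ⟨(s.val v).unpair.2, by rw [← h, Nat.pair_unpair]⟩

@[simp] theorem sat_entry {s i x : L2Term} (hs : s.Below k) (hi : i.Below k) (hx : x.Below k) :
    Sat (entry s i x k l) v V ↔ (seqOf (s.val v))[i.val v]? = some (x.val v) := by
  simp (maxDischargeDepth := 8) [entry, Nat.add_assoc, hs, hi, hx,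
    L2Term.Below.add_right, getElem?_seqOf_eq_some, Nat.beta]
  constructor
  · rintro ⟨m, b, ⟨q, h⟩, h1, h2⟩
    simp only [h, Nat.unpair_pair]
    refine ⟨h1, ?_⟩
    rw [Nat.mul_add_mod_self_right, Nat.mod_eq_of_lt (Nat.lt_succ_of_le h2)]
  · rintro ⟨h1, h2⟩
    set c := (s.val v).unpair.2
    set m := (i.val v + 1) * c.unpair.2
    refine ⟨(s.val v).unpair.1, c.unpair.2, ⟨c.unpair.1 / (m + 1), ?_⟩, h1, ?_⟩
    · rw [← h2, Nat.div_add_mod', Nat.pair_unpair, Nat.pair_unpair]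
    · exact h2 ▸ Nat.le_of_lt_succ (Nat.mod_lt _ (Nat.succ_pos m))

@[simp] theorem sat_sameSeq (hs : s.Below k) (ht : t.Below k) :
    Sat (sameSeq s t k l) v V ↔ seqOf (s.val v) = seqOf (t.val v) := by
  simp (maxDischargeDepth := 8) [sameSeq, hs, ht, L2Term.Below.add_right,
    ext_seqOf]
  -- Agreement of all entries already forces equal lengths, so the length clause is redundant.
  exact fun h => by rw [h]

@[simp] theorem sat_isSeq (hs : s.Below k) : Sat (isSeq s k l) v V ↔ IsCode (s.val v) := by
  simp (maxDischargeDepth := 8) [isSeq, IsCode, hs, L2Term.Below.add_right]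

@[simp] theorem sat_isPrefix (hs : s.Below k) (ht : t.Below k) :
    Sat (isPrefix s t k l) v V ↔ seqOf (s.val v) <+: seqOf (t.val v) := by
  simp (maxDischargeDepth := 8) [isPrefix, hs, ht, L2Term.Below.add_right,
    ← prefix_iff_getElem?]
  exact fun h => h.length_le

@[simp] theorem sat_isTree {T : ℕ} : Sat (isTree T k l) v V ↔ ∀ s ∈ V T, IsCode s ∧
    ∀ t, IsCode t → seqOf t <+: seqOf s → t ∈ V T := by
  simp (maxDischargeDepth := 8) [isTree, and_imp]

@[simp] theorem sat_isPerfect {S : ℕ} : Sat (isPerfect S k l) v V ↔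
    (∀ s ∈ V S, IsCode s ∧ ∀ t, IsCode t → seqOf t <+: seqOf s → t ∈ V S) ∧ (∃ s, s ∈ V S) ∧
    ∀ s ∈ V S, ∃ t u, t ∈ V S ∧ u ∈ V S ∧ seqOf s <+: seqOf t ∧ seqOf s <+: seqOf u ∧
      ¬ seqOf t <+: seqOf u ∧ ¬ seqOf u <+: seqOf t := by
  simp (maxDischargeDepth := 8) [isPerfect, Nat.add_assoc]

@[simp] theorem sat_isSubset {S T : ℕ} : Sat (isSubset S T k l) v V ↔ V S ⊆ V T := by
  simp [isSubset, Set.subset_def]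

@[simp] theorem sat_isFunction {F : ℕ} : Sat (isFunction F k l) v V ↔
    (∀ n, ∃ m, Nat.pair n m ∈ V F) ∧
      ∀ n m m', Nat.pair n m ∈ V F → Nat.pair n m' ∈ V F → m = m' := by
  simp (maxDischargeDepth := 8) [isFunction, Nat.add_assoc]

@[simp] theorem sat_isPath {F T : ℕ} : Sat (isPath F T k l) v V ↔
    ((∀ n, ∃ m, Nat.pair n m ∈ V F) ∧
      ∀ n m m', Nat.pair n m ∈ V F → Nat.pair n m' ∈ V F → m = m') ∧
    ∀ s, IsCode s → (∀ i x : ℕ, (seqOf s)[i]? = some x → Nat.pair i x ∈ V F) → s ∈ V T := by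
  simp (maxDischargeDepth := 8) [isPath, Nat.add_assoc]

@[simp] theorem sat_listedBefore {d i e a b : L2Term} (hd : d.Below k) (hi : i.Below k)
    (he : e.Below k) (ha : a.Below k) (hb : b.Below k) :
    Sat (listedBefore d i e a b k l) v V ↔
      claim (e.val v) (a.val v) (b.val v) ∈ (seqOf (d.val v)).take (i.val v) := by
  simp (maxDischargeDepth := 8) [listedBefore, Nat.add_assoc,
    L2Term.Below.add_right, hd, hi, he, ha, hb, List.mem_take_iff_getElem]
  exact ⟨fun ⟨j, h1, h2⟩ => by
      obtain ⟨h3, h4⟩ := List.getElem?_eq_some_iff.1 h2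
      exact ⟨j, ⟨h1, h3⟩, h4⟩,
    fun ⟨j, ⟨h1, h3⟩, h4⟩ => ⟨j, h1, List.getElem?_eq_some_iff.2 ⟨h3, h4⟩⟩⟩

@[simp] theorem sat_justified {Y : ℕ} {d i e a b : L2Term} (hd : d.Below k) (hi : i.Below k)
    (he : e.Below k) (ha : a.Below k) (hb : b.Below k) :
    Sat (justified Y d i e a b k l) v V ↔
      Justified (charFun (V Y)) ((seqOf (d.val v)).take (i.val v)) (e.val v) (a.val v)
        (b.val v) := by
  simp (maxDischargeDepth := 8) [justified, Nat.add_assoc,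
    L2Term.Below.add_right, hd, hi, he, ha, hb]
  generalize (seqOf (d.val v)).take (i.val v) = P
  generalize e.val v = e
  generalize a.val v = a
  generalize b.val v = b
  unfold Justified
  rw [exists_eq_pair_pair, exists_eq_pair_pair, exists_eq_pair_pair, exists_eq_pair]
  refine or_congr .rfl <| or_congr .rfl <| or_congr ?_ <| or_congr ?_ <| or_congr ?_ <|
    or_congr ?_ <| or_congr ?_ <| or_congr ?_ ?_ <;> refine and_congr_right fun _ => ?_
  · exact ⟨fun ⟨n, h⟩ => by simp [h], fun h => ⟨a.unpair.2, by simp [h]⟩⟩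
  · exact ⟨fun ⟨n, h⟩ => by simp [h], fun h => ⟨a.unpair.1, by simp [h]⟩⟩
  · by_cases h : a ∈ V Y <;> simp [charFun, h]
  · constructor
    · rintro ⟨u, hu, w, hw, rfl⟩
      simp [hu, hw]
    · rintro ⟨hu, hw⟩
      exact ⟨_, hu, _, hw, (Nat.pair_unpair b).symm⟩
  · exact exists_claim_mem.symm
  · obtain ⟨x, n, rfl⟩ : ∃ x n, a = Nat.pair x n := ⟨_, _, (Nat.pair_unpair a).symm⟩
    simp only [Nat.unpair_pair]
    rw [exists_claim_mem (Q := fun u => claim e.unpair.2.unpair.2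
      (Nat.pair x (Nat.pair (n - 1) u)) b ∈ P)]
    constructor
    · rintro ⟨x', n', h, H⟩
      obtain ⟨rfl, rfl⟩ := Nat.pair_eq_pair.1 h
      rcases H with H | ⟨m, rfl, H⟩
      · exact .inl H
      · exact .inr ⟨by simp, H⟩
    · rintro (H | ⟨hn, H⟩)
      · exact ⟨x, n, rfl, .inl H⟩
      -- The formula writes the recursion argument as a successor, whereas `Justified` subtracts one
      -- from a nonzero number.
      · exact ⟨x, n, rfl, .inr ⟨n - 1, by omega, H⟩⟩
  · refine and_congr_right fun _ => forall₂_congr fun m _ => ?_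
    rw [exists_claim_mem (Q := fun u => u ≠ 0)]
    exact ⟨fun ⟨u, hu⟩ => ⟨_, hu, by simp⟩, fun ⟨u, hu, h⟩ =>
      ⟨u - 1, by rwa [Nat.sub_add_cancel (Nat.pos_of_ne_zero h)]⟩⟩

@[simp] theorem sat_isRecord {Y : ℕ} {d : L2Term} (hd : d.Below k) :
    Sat (isRecord Y d k l) v V ↔ IsRecord (charFun (V Y)) (seqOf (d.val v)) := by
  simp (maxDischargeDepth := 8) [isRecord, Nat.add_assoc, L2Term.Below.add_right, hd]
  constructor
  · intro H n hn
    obtain ⟨e, a, b, h, hJ⟩ := H n _ (List.getElem?_eq_getElem hn)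
    rw [List.getD_eq_getElem _ _ hn, h]
    simpa using hJ
  · intro H n p hp
    obtain ⟨hn, rfl⟩ := List.getElem?_eq_some_iff.1 hp
    have := H n hn
    rw [List.getD_eq_getElem _ _ hn] at this
    exact ⟨_, _, _, by simp, this⟩

@[simp] theorem sat_computes {Y : ℕ} {e a b : L2Term} (he : e.Below k) (ha : a.Below k)
    (hb : b.Below k) : Sat (computes Y e a b k l) v V ↔
      Derivable (charFun (V Y)) (claim (e.val v) (a.val v) (b.val v)) := by
  simp (maxDischargeDepth := 8) [computes, Nat.add_assoc, L2Term.Below.add_right, he, ha, hb]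
  constructor
  · rintro ⟨n, h1, h2⟩
    exact ⟨_, h1, h2⟩
  · rintro ⟨L, h1, h2⟩
    obtain ⟨n, rfl⟩ := seqOf_surjective L
    exact ⟨n, h1, h2⟩

@[simp] theorem sat_turingLE {X Y : ℕ} : Sat (turingLE X Y k l) v V ↔
    ∃ e, ∀ n, Derivable (charFun (V Y)) (claim e n (charFun (V X) n)) := by
  simp (maxDischargeDepth := 8) [turingLE, Nat.add_assoc]
  refine exists_congr fun e => forall_congr' fun n => ?_
  by_cases h : n ∈ V X <;> simp [charFun, h]

end Scheme

open Scheme in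
theorem sat_wMPT {v : ℕ → ℕ} {V : ℕ → Set ℕ} : Sat wMPT v V ↔ ∀ T ∈ arithmeticalSets,
    (∀ s ∈ T, IsCode s ∧ ∀ t, IsCode t → seqOf t <+: seqOf s → t ∈ T) →
    (∀ X ∈ arithmeticalSets, ∃ F ∈ arithmeticalSets,
      (((∀ n, ∃ m, Nat.pair n m ∈ F) ∧ ∀ n m m', Nat.pair n m ∈ F → Nat.pair n m' ∈ F → m = m') ∧
      ∀ s, IsCode s → (∀ i x : ℕ, (seqOf s)[i]? = some x → Nat.pair i x ∈ F) → s ∈ T) ∧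
      ∃ e, ∀ n, Derivable (charFun F) (claim e n (charFun X n))) →
    ∃ S ∈ arithmeticalSets,
      ((∀ s ∈ S, IsCode s ∧ ∀ t, IsCode t → seqOf t <+: seqOf s → t ∈ S) ∧ (∃ s, s ∈ S) ∧
        ∀ s ∈ S, ∃ t u, t ∈ S ∧ u ∈ S ∧ seqOf s <+: seqOf t ∧ seqOf s <+: seqOf u ∧
          ¬ seqOf t <+: seqOf u ∧ ¬ seqOf u <+: seqOf t) ∧ S ⊆ T := by
  rw [wMPT, Scheme.sat_allSet]
  refine forall₂_congr fun T _ => ?_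
  rw [Scheme.sat_imp, Scheme.sat_and, and_imp, Scheme.sat_exSet, isCofinal, Scheme.sat_allSet]
  refine imp_congr ?_ (imp_congr (forall₂_congr fun X _ => ?_) (exists_congr fun S =>
    and_congr_right fun _ => ?_))
  · simp
  · rw [Scheme.sat_exSet]
    refine exists_congr fun F => and_congr_right fun _ => ?_
    simp [-not_exists, -not_forall]
  · rw [Scheme.sat_and]
    simp

/-! ## Failure of `wMPT` in the arithmetical model -/

/-- A sequence has several β-codes. Taking the least one as its representative lets sets of numbers
stand for sets of sequences. -/
theorem exists_isCode (σ : List ℕ) : ∃ s, IsCode s ∧ seqOf s = σ := by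
  classical
  have h := seqOf_surjective σ
  exact ⟨Nat.find h, fun t ht he => Nat.find_min h ht (he.trans (Nat.find_spec h)), Nat.find_spec h⟩

theorem primrecPred_isCode : PrimrecPred IsCode := by
  refine .of_forall_lt Primrec.id (PrimrecPred.not ?_)
  exact Primrec.eq.comp (primrec_seqOf.comp Primrec.fst) (primrec_seqOf.comp Primrec.snd)

/-- A recursive tree with cofinally many arithmetical paths and no perfect subtree refutes `wMPT`
in the arithmetical model. -/
theorem not_sat_wMPT {U : Set (List ℕ)} (hU : IsTree U) (hrec : PrimrecPred fun σ => σ ∈ U)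
    (hcof : ∀ x, IsArithmeticalReal x → ∃ y ∈ treePaths U, IsArithmeticalReal y ∧ TuringLE x y)
    (hperf : ¬ ∃ S, IsPerfectTree S ∧ S ⊆ U) (v : ℕ → ℕ) (V : ℕ → Set ℕ) : ¬ Sat wMPT v V := by
  intro H
  refine absurd (sat_wMPT.1 H {s | IsCode s ∧ seqOf s ∈ U}
    (mem_arithmeticalSets_of_primrecPred (primrecPred_isCode.and (hrec.comp primrec_seqOf)))
    (fun s hs => ⟨hs.1, fun t ht hts => ⟨ht, hU _ hs.2 _ hts⟩⟩) fun X hX => ?_) ?_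
  rotate_left
  · rintro ⟨S, -, ⟨hS, ⟨s₀, hs₀⟩, hsplit⟩, hsub⟩
    refine hperf ⟨seqOf '' S, ⟨?_, ⟨_, s₀, hs₀, rfl⟩, ?_⟩, ?_⟩
    · rintro _ ⟨s, hs, rfl⟩ τ hτ
      obtain ⟨t, ht, rfl⟩ := exists_isCode τ
      exact ⟨t, (hS s hs).2 t ht hτ, rfl⟩
    · rintro _ ⟨s, hs, rfl⟩
      obtain ⟨t, u, ht, hu, h⟩ := hsplit s hs
      exact ⟨_, ⟨t, ht, rfl⟩, _, ⟨u, hu, rfl⟩, h⟩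
    · rintro _ ⟨s, hs, rfl⟩
      exact (hsub hs).2
  · obtain ⟨y, hy, hya, hxy⟩ := hcof _ hX
    -- In the model a path is given by its graph, which has the same Turing degree as the path.
    set F : Set ℕ := {p | y p.unpair.1 = p.unpair.2} with hF
    have hmem : ∀ n m, Nat.pair n m ∈ F ↔ y n = m := fun n m => by simp [hF]
    have hFy : TuringLE (charFun F) y := by
      have h1 : TuringLE (charFun {p : ℕ | p.unpair.1 = p.unpair.2}) y :=
        .charFun_of_primrecPred (Primrec.eq.comp Primrec.id.unpair_fst Primrec.id.unpair_snd)
      have := h1.charFun_preimage (((TuringLE.refl y).comp (.of_primrec Primrec.id.unpair_fst)).pair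
        (.of_primrec Primrec.id.unpair_snd))
      simpa using this
    have hyF : TuringLE y (charFun F) :=
      .find_of_charFun (.refl _) (fun n => (hmem _ _).2 rfl)
        fun n m hm h => hm.ne' ((hmem _ _).1 h)
    refine ⟨F, mem_arithmeticalSets_of_turingLE hFy hya, ⟨⟨fun n => ⟨y n, (hmem _ _).2 rfl⟩,
      fun n m m' h h' => ((hmem _ _).1 h).symm.trans ((hmem _ _).1 h')⟩, fun s hs h => ⟨hs, ?_⟩⟩, ?_⟩
    · convert hy (seqOf s).length using 1
      refine List.ext_getElem (by simp) fun i hi _ => ?_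
      simpa using ((hmem _ _).1 (h i _ (List.getElem?_eq_getElem hi))).symm
    -- The formal reducibility has only to be verified here, so completeness of records suffices;
    -- whether a derivable claim concerns a genuine index does not matter.
    · obtain ⟨c, hc⟩ := OracleCode.exists_code (TuringLE.iff_partRecIn.1 (hxy.trans hyF))
      exact ⟨c.index, fun n => derivable_of_mem_eval c (by rw [hc]; exact Part.mem_some _)⟩

theorem mainTheorem6 :
    ¬ TheoryImplies ACA0 wMPT ∧
    arithmeticalModel.ModelsTheory ACA0 ∧
    ¬ arithmeticalModel.Models wMPT ∧
    ∃ T : ℕ → Set (List ℕ),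
      (∀ n, IsTree (T n)) ∧
      ComputablePred (fun p : ℕ × List ℕ => p.2 ∈ T p.1) ∧
      (∀ n, ∃ x : ℕ → ℕ, treePaths (T n) = {x} ∧
        TuringLE x (charFun (zeroJump n)) ∧ TuringLE (charFun (zeroJump n)) x) ∧
      IsTree (unionTree T) ∧
      ComputablePred (fun σ : List ℕ => σ ∈ unionTree T) ∧
      (treePaths (unionTree T)).Countable ∧
      (∀ x, IsArithmeticalReal x →
        ∃ y ∈ treePaths (unionTree T), IsArithmeticalReal y ∧ TuringLE x y) ∧
      ¬ ∃ S, IsPerfectTree S ∧ S ⊆ unionTree T := by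
  have hpaths := treePaths_unionTree_eq_range treePaths_jumpTree
  have htree := isTree_unionTree isTree_jumpTree
  have hrec := primrecPred_unionTree primrecPred_jumpTree
  have hcof : ∀ x, IsArithmeticalReal x →
      ∃ y ∈ treePaths (unionTree jumpTree), IsArithmeticalReal y ∧ TuringLE x y := by
    rintro x ⟨n, hx⟩
    -- A real below ∅⁽ⁿ⁾ is computed by the path n⌢`jumpPath n`.
    exact ⟨_, hpaths.symm ▸ Set.mem_range_self n, ⟨n, (consReal_turingLE _ _).trans (turingLE_jumpPath n)⟩,
      hx.trans ((zeroJump_turingLE_jumpPath n).trans (turingLE_consReal _ _))⟩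
  have hperf : ¬ ∃ S, IsPerfectTree S ∧ S ⊆ unionTree jumpTree := fun ⟨_, hS, hsub⟩ =>
    not_isPerfectTree_of_subset_unionTree
      (fun n => treePaths_jumpTree n ▸ Set.subsingleton_singleton) hsub hS
  have hnot : ¬ arithmeticalModel.Models wMPT := fun H =>
    not_sat_wMPT htree hrec hcof hperf (fun _ => 0) (fun _ => ∅)
      (arithmeticalModel_models_iff.1 H _ _ fun _ => ⟨0, .of_primrec
        ((Primrec.const 0).of_eq fun _ => (charFun_of_notMem (Set.notMem_empty _)).symm)⟩)
  exact ⟨fun H => hnot (H _ arithmeticalModel_modelsTheory_ACA0),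
    arithmeticalModel_modelsTheory_ACA0, hnot, jumpTree, isTree_jumpTree,
    primrecPred_jumpTree.computablePred,
    fun n => ⟨_, treePaths_jumpTree n, turingLE_jumpPath n, zeroJump_turingLE_jumpPath n⟩,
    htree, hrec.computablePred, hpaths ▸ Set.countable_range _, hcof, hperf⟩
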